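/- **Setting.** Let $0\le r<d$. Let $\boldsymbol{x}$ be a square-integrable random vector in $\mathbb{R}^d$ with $\mathbb{E}[\boldsymbol{x}]=0$ and invertible covariance matrix $\Sigma_{\boldsymbol{x}}=\mathbb{E}[\boldsymbol{x}\boldsymbol{x}^\top]$, let $\boldsymbol{n}$ be a square-integrable real random variable with $\mathbb{E}[\boldsymbol{n}\mid\boldsymbol{x}]=0$, and let $S\in\mathbb{R}^{d\times d}$ be symmetric positive definite. For $R\in\mathbb{R}^{d\times r}$ and $f\in\mathbb{R}^d$ put $\boldsymbol{y}=f^\top\boldsymbol{x}+\boldsymbol{n}$ and $$\mathrm{regret}(R,f)=\inf_{q\in\mathbb{R}^r}\mathbb{E}\big[(\boldsymbol{y}-q^\top R^\top\boldsymbol{x})^2\big]-\inf_{q\in\mathbb{R}^d}\mathbb{E}\big[(\boldsymbol{y}-q^\top\boldsymbol{x})^2\big].$$ Let $\mathcal{F}_S=\{f\in\mathbb{R}^d: f^\top S^{-1}f\le 1\}$. The mixed-strategy minimax regret is $$\mathrm{regret}_{\mathrm{mix}}(\mathcal{F}_S\mid\Sigma_{\boldsymbol{x}})=\inf_{\mu}\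 \sup_{f\in\mathcal{F}_S}\ \mathbb{E}_{\boldsymbol{R}\sim\mu}[\mathrm{regret}(\boldsymbol{R},f)],$$ where $\mu$ runs over all Borel probability measures on $\mathbb{R}^{d\times r}$; a minimax representation is a random matrix $\boldsymbol{R}$ whose law attains this infimum. A least favorable prior is a probability measure $\pi$ supported on $\mathcal{F}_S$ that maximizes $\inf_{R\in\mathbb{R}^{d\times r}}\mathbb{E}_{\boldsymbol{f}\sim\pi}[\mathrm{regret}(R,\boldsymbol{f})]$ over all such measures. Let $S^{1/2}\Sigma_{\boldsymbol{x}}S^{1/2}=V\,\mathrm{diag}(\lambda_1,\dots,\lambda_d)\,V^\top$ and $\Sigma_{\boldsymbol{x}}^{1/2}S\,\Sigma_{\boldsymbol{x}}^{1/2}=W\,\mathrm{diag}(\lambda'_1,\dots,\lambda'_d)\,W^\top$ be any eigenvalue decompositions with $V,W$ orthogonal, $\lambda_1\ge\dots\ge\lambda_d$ and $\lambda'_1\ge\dots\ge\lambda'_d$; put $\lambda_{d+1}=0$ and $\lambda_{d+1}^{-1}=+\infty$. **Theorem.** All the expectations and suprema above are finite. There is an $\ell\in\{r+1,\dots,d\}$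 with $$(\ell-r)\,\lambda_\ell^{-1}\ \le\ \sum_{i=1}^{\ell}\lambda_i^{-1}\ \le\ (\ell-r)\,\lambda_{\ell+1}^{-1},$$ and for every such $\ell=\ell^*$ the following hold. 1. $\displaystyle \mathrm{regret}_{\mathrm{mix}}(\mathcal{F}_S\mid\Sigma_{\boldsymbol{x}})=\frac{\ell^*-r}{\sum_{i=1}^{\ell^*}\lambda_i^{-1}}.$ 2. Let $\displaystyle \Sigma_{\boldsymbol{f}}^*=\frac{S^{1/2}\,V\,\mathrm{diag}(\lambda_1^{-1},\dots,\lambda_{\ell^*}^{-1},0,\dots,0)\,V^\top S^{1/2}}{\sum_{i=1}^{\ell^*}\lambda_i^{-1}}$. There is a centred probability measure supported on $\mathcal{F}_S$ with covariance matrix $\Sigma_{\boldsymbol{f}}^*$. Every probability measure $\pi$ supported on $\mathcal{F}_S$ with $\mathbb{E}_{\boldsymbol{f}\sim\pi}[\boldsymbol{f}\boldsymbol{f}^\top]=\Sigma_{\boldsymbol{f}}^*$ is a least favorable prior, and $\inf_{R}\mathbb{E}_{\boldsymbol{f}\sim\pi}[\mathrm{regret}(R,\boldsymbol{f})]$ equals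 the value in (1). 3. Let $\overline{A}\in\{0,1\}^{\ell^*\times\binom{\ell^*}{r}}$ be the matrix whose columns are the vectors in $\{0,1\}^{\ell^*}$ with exactly $\ell^*-r$ ones, the column indexed by an $r$-element set $I\subseteq\{1,\dots,\ell^*\}$ being the one whose zeros are at the positions in $I$; let $\overline{b}\in\mathbb{R}^{\ell^*}$ have entries $b_i=(\ell^*-r)\,\lambda_i^{-1}/\sum_{j=1}^{\ell^*}\lambda_j^{-1}$. Then there is a solution $p\in[0,1]^{\binom{\ell^*}{r}}$ of $\overline{A}p=\overline{b}$ with at most $\ell^*+1$ nonzero entries. Moreover, every solution $p\in[0,1]^{\binom{\ell^*}{r}}$ of $\overline{A}p=\overline{b}$ is a probability vector, and the random matrix $\boldsymbol{R}^*$ equal to $\Sigma_{\boldsymbol{x}}^{-1/2}W_I$ with probability $p_I$ is a minimax representation, with worst-case expected regret over $\mathcal{F}_S$ equal to the value in (1); here $W_I$ is the $d\times r$ matrix of the columns of $W$ with index in $I$. -/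

import Mathlib

open MeasureTheory
open scoped Matrix

namespace LinearMSE

noncomputable section

/-- The `σ`-algebra on `m × n` real matrices: the product `σ`-algebra of the entries, which is the
Borel one for finite `m`, `n`. -/
instance instMeasurableSpaceMatrix {m n : Type*} : MeasurableSpace (Matrix m n ℝ) :=
  inferInstanceAs (MeasurableSpace (m → n → ℝ))

/-- `E[x xᵀ]` for a random vector `x` on `(Ω, P)`. -/
def secondMoment {Ω : Type*} [MeasurableSpace Ω] {d : ℕ} (P : Measure Ω) (x : Ω → Fin d → ℝ) :
    Matrix (Fin d) (Fin d) ℝ :=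
  Matrix.of fun i j => ∫ ω, x ω i * x ω j ∂P

section Sqrt

open scoped MatrixOrder

/-- The symmetric positive semidefinite square root `M^{1/2}` of a positive semidefinite matrix. -/
def matSqrt {d : ℕ} (M : Matrix (Fin d) (Fin d) ℝ) : Matrix (Fin d) (Fin d) ℝ :=
  CFC.sqrt M

end Sqrt

/-- `M = V diag(lam) Vᵀ` with `V` orthogonal and the eigenvalues `lam` in non-increasing order
(`lam i` is the `(i+1)`-st largest eigenvalue, column `i` of `V` is a corresponding eigenvector). -/
def IsSortedEigendecomposition {d : ℕ} (M : Matrix (Fin d) (Fin d) ℝ) (lam : Fin d → ℝ)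
    (V : Matrix (Fin d) (Fin d) ℝ) : Prop :=
  Antitone lam ∧ Vᵀ * V = 1 ∧ M = V * Matrix.diagonal lam * Vᵀ

/-! ### Regret -/

section Regret

variable {Ω : Type*} [MeasurableSpace Ω] {d r : ℕ}

/-- The least mean squared error of predicting `y` by a linear function `qᵀ z` of `z`. -/
def minMSE {k : ℕ} (P : Measure Ω) (y : Ω → ℝ) (z : Ω → Fin k → ℝ) : ℝ :=
  ⨅ q : Fin k → ℝ, ∫ ω, (y ω - q ⬝ᵥ z ω) ^ 2 ∂P

/-- The pointwise regret of the representation `z = Rᵀ x` for the response `y = fᵀ x + n`. -/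
def regret (P : Measure Ω) (x : Ω → Fin d → ℝ) (n : Ω → ℝ)
    (R : Matrix (Fin d) (Fin r) ℝ) (f : Fin d → ℝ) : ℝ :=
  minMSE P (fun ω => f ⬝ᵥ x ω + n ω) (fun ω => Rᵀ *ᵥ x ω) -
    minMSE P (fun ω => f ⬝ᵥ x ω + n ω) x

/-- The class `F_S = {f : fᵀ S⁻¹ f ≤ 1}`. -/
def ellipsoid (S : Matrix (Fin d) (Fin d) ℝ) : Set (Fin d → ℝ) :=
  {f | f ⬝ᵥ (S⁻¹ *ᵥ f) ≤ 1}

/-- The worst-case expected regret over `F_S` of a random representation with law `μ`. -/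
def worstRegret (P : Measure Ω) (x : Ω → Fin d → ℝ) (n : Ω → ℝ) (S : Matrix (Fin d) (Fin d) ℝ)
    (μ : Measure (Matrix (Fin d) (Fin r) ℝ)) : ℝ :=
  ⨆ f : ellipsoid S, ∫ R, regret P x n R f ∂μ

/-- The minimax regret in mixed strategies, over all laws of random `d × r` representations. -/
def mixedRegret (r : ℕ) (P : Measure Ω) (x : Ω → Fin d → ℝ) (n : Ω → ℝ)
    (S : Matrix (Fin d) (Fin d) ℝ) : ℝ :=
  ⨅ μ : ProbabilityMeasure (Matrix (Fin d) (Fin r) ℝ),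
    worstRegret P x n S (μ : Measure (Matrix (Fin d) (Fin r) ℝ))

/-- `μ` is the law of a random representation attaining the minimax regret in mixed strategies. -/
def IsMinimaxRepresentation (P : Measure Ω) (x : Ω → Fin d → ℝ) (n : Ω → ℝ)
    (S : Matrix (Fin d) (Fin d) ℝ) (μ : Measure (Matrix (Fin d) (Fin r) ℝ)) : Prop :=
  IsProbabilityMeasure μ ∧
    ∀ μ' : Measure (Matrix (Fin d) (Fin r) ℝ), IsProbabilityMeasure μ' →
      worstRegret P x n S μ ≤ worstRegret P x n S μ'

/-- A prior: a probability law of the response vector supported on `F_S`. -/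
def IsPrior (S : Matrix (Fin d) (Fin d) ℝ) (π : Measure (Fin d → ℝ)) : Prop :=
  IsProbabilityMeasure π ∧ ∀ᵐ f ∂π, f ∈ ellipsoid S

/-- The least expected regret that a single `d × r` representation achieves against the prior `π`. -/
def priorRegret (r : ℕ) (P : Measure Ω) (x : Ω → Fin d → ℝ) (n : Ω → ℝ)
    (π : Measure (Fin d → ℝ)) : ℝ :=
  ⨅ R : Matrix (Fin d) (Fin r) ℝ, ∫ f, regret P x n R f ∂π

/-- `π` is a least favorable prior: it attains the maximin regret in mixed strategies. -/
def IsLeastFavorable (r : ℕ) (P : Measure Ω) (x : Ω → Fin d → ℝ) (n : Ω → ℝ)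
    (S : Matrix (Fin d) (Fin d) ℝ) (π : Measure (Fin d → ℝ)) : Prop :=
  IsPrior S π ∧
    ∀ π' : Measure (Fin d → ℝ), IsPrior S π' → priorRegret r P x n π' ≤ priorRegret r P x n π

end Regret

/-! ### The quantities in the solution -/

section Solution

variable {d : ℕ}

/-- `λ₁⁻¹ + ⋯ + λ_ℓ⁻¹`. -/
def invSum (lam : Fin d → ℝ) (ℓ : ℕ) : ℝ :=
  ∑ i : Fin d with i.val < ℓ, (lam i)⁻¹

/-- `ℓ ∈ {r+1, …, d}` and `(ℓ - r) λ_ℓ⁻¹ ≤ ∑_{i ≤ ℓ} λ_i⁻¹ ≤ (ℓ - r) λ_{ℓ+1}⁻¹`.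
With zero-based indices, `λ_ℓ` is the `lam i` with `i + 1 = ℓ` and `λ_{ℓ+1}` the one with `i = ℓ`;
for `ℓ = d` there is none, and the upper bound is void (`λ_{d+1} = 0`, so `λ_{d+1}⁻¹ = ∞`). -/
def IsEffectiveDim (r : ℕ) (lam : Fin d → ℝ) (ℓ : ℕ) : Prop :=
  r < ℓ ∧ ℓ ≤ d ∧
    (∀ i : Fin d, i.val + 1 = ℓ → ((ℓ : ℝ) - r) * (lam i)⁻¹ ≤ invSum lam ℓ) ∧
    (∀ i : Fin d, i.val = ℓ → invSum lam ℓ ≤ ((ℓ : ℝ) - r) * (lam i)⁻¹)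

/-- `S^{1/2} V diag(λ₁⁻¹, …, λ_ℓ⁻¹, 0, …, 0) Vᵀ S^{1/2} / ∑_{i ≤ ℓ} λ_i⁻¹`. -/
def leastFavorableCov (S : Matrix (Fin d) (Fin d) ℝ) (lam : Fin d → ℝ)
    (V : Matrix (Fin d) (Fin d) ℝ) (ℓ : ℕ) : Matrix (Fin d) (Fin d) ℝ :=
  (invSum lam ℓ)⁻¹ •
    (matSqrt S * (V * Matrix.diagonal (fun i : Fin d => if i.val < ℓ then (lam i)⁻¹ else 0) * Vᵀ) *
      matSqrt S)

/-- The `r`-element subsets of `{1, …, ℓ}`. -/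
abbrev RSubset (ℓ r : ℕ) : Type := {I : Finset (Fin ℓ) // I.card = r}

/-- The `ℓ × (ℓ choose r)` matrix whose columns are the vectors in `{0,1}^ℓ` with `ℓ - r` ones;
such a vector is indexed by the set `I` of its `r` zeros. -/
def incidence (ℓ r : ℕ) : Matrix (Fin ℓ) (RSubset ℓ r) ℝ :=
  Matrix.of fun i I => if i ∈ I.1 then 0 else 1

/-- `b_i = (ℓ - r) λ_i⁻¹ / ∑_{j ≤ ℓ} λ_j⁻¹` for `i ≤ ℓ`. -/
def bVec (r : ℕ) (lam : Fin d → ℝ) {ℓ : ℕ} (hℓ : ℓ ≤ d) : Fin ℓ → ℝ :=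
  fun i => ((ℓ : ℝ) - r) * ((lam (Fin.castLE hℓ i))⁻¹ / invSum lam ℓ)

/-- `p ∈ [0,1]^(ℓ choose r)` and `Ā p = b̄`. -/
def IsWeightVector (r : ℕ) (lam : Fin d → ℝ) {ℓ : ℕ} (hℓ : ℓ ≤ d) (p : RSubset ℓ r → ℝ) : Prop :=
  (∀ I, p I ∈ Set.Icc (0 : ℝ) 1) ∧ incidence ℓ r *ᵥ p = bVec r lam hℓ

/-- The `d × r` matrix `W_I` of the columns of `W` with index in `I`, in increasing order. -/
def colSubset {ℓ r : ℕ} (hℓ : ℓ ≤ d) (W : Matrix (Fin d) (Fin d) ℝ) (I : RSubset ℓ r) :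
    Matrix (Fin d) (Fin r) ℝ :=
  W.submatrix id (fun k => Fin.castLE hℓ (I.1.orderEmbOfFin I.2 k))

/-- The law of the random representation equal to `Σ^{-1/2} W_I` with probability `p_I`. -/
def mixtureLaw {ℓ r : ℕ} (hℓ : ℓ ≤ d) (Sig W : Matrix (Fin d) (Fin d) ℝ) (p : RSubset ℓ r → ℝ) :
    Measure (Matrix (Fin d) (Fin r) ℝ) :=
  ∑ I, ENNReal.ofReal (p I) • Measure.dirac ((matSqrt Sig)⁻¹ * colSubset hℓ W I)

end Solution

end

end LinearMSE

open LinearMSE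

/-! The noise is uncorrelated with `x`, so it cancels from the regret. What remains is the squared
distance from `H f` to the range of `H R`, where `H` is the square root of the covariance matrix of
`x`. Both players' bounds are then explicit and meet at `v = (ℓ - r) / invSum lam ℓ`.

Lower bound (`le_integral_loss`). If `f` has second moment `leastFavorableCov`, then `H f` has
second moment `(invSum lam ℓ)⁻¹` times an orthogonal projection of rank `ℓ`. A representation
removes at most `r` dimensions, and the trace of a rank-`m` projection against a matrix with
eigenvalues at most 1 is at most `m`. Hence every `R` leaves an expected loss of at least `v`.

Upper bound (`IsWeightVector.sum_loss_le`). Write `a = Wᵀ H f`, so that `fᵀ S⁻¹ f = ∑ λ_i⁻¹ a_i²`.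
Playing `H⁻¹ W_I` costs at most the sum of `a_i²` over `i ∉ I`. On average `a_i²` gets the
coefficient `v λ_i⁻¹` for `i ≤ ℓ`, by `Ā p = b̄`, and the coefficient 1 for `i > ℓ`, which the
second inequality defining `ℓ` bounds by `v λ_i⁻¹`. The total is at most `v fᵀ S⁻¹ f ≤ v`.

The first inequality defining `ℓ` says that `b̄` has entries at most 1. Birkhoff's theorem then puts
`b̄` in the convex hull of the columns of `Ā` (`mem_convexHull_incidence`), and Carathéodory's
theorem gives sparse weights. -/

namespace LinearMSE

noncomputable section

/-! ### Quadratic forms -/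

section Quadratic

variable {m n : Type*} [Fintype m] [Fintype n]

/-- The quadratic form of a matrix. -/
def quad (M : Matrix m m ℝ) (v : m → ℝ) : ℝ := v ⬝ᵥ (M *ᵥ v)

theorem quad_eq_sum (M : Matrix m m ℝ) (v : m → ℝ) :
    quad M v = ∑ i, ∑ j, M i j * (v i * v j) := by
  simp only [quad, dotProduct, Matrix.mulVec, Finset.mul_sum]
  exact Finset.sum_congr rfl fun i _ => Finset.sum_congr rfl fun j _ => by ring

theorem quad_transpose_mul_mul (A : Matrix n m ℝ) (M : Matrix n n ℝ) (v : m → ℝ) :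
    quad (Aᵀ * M * A) v = quad M (A *ᵥ v) := by
  simp only [quad, ← Matrix.mulVec_mulVec]
  rw [Matrix.mulVec_transpose, dotProduct_comm, ← Matrix.dotProduct_mulVec, dotProduct_comm]

theorem quad_transpose_mul (A : Matrix n m ℝ) (v : m → ℝ) :
    quad (Aᵀ * A) v = (A *ᵥ v) ⬝ᵥ (A *ᵥ v) := by
  classical
  simpa [quad] using quad_transpose_mul_mul A 1 v

theorem quad_diagonal [DecidableEq m] (c v : m → ℝ) :
    quad (Matrix.diagonal c) v = ∑ i, c i * v i ^ 2 := by
  simp only [quad, Matrix.mulVec_diagonal, dotProduct]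
  exact Finset.sum_congr rfl fun i _ => by ring

theorem continuous_quad (M : Matrix m m ℝ) : Continuous (quad M) := by
  unfold quad dotProduct Matrix.mulVec dotProduct
  fun_prop

theorem quad_nonneg {M : Matrix m m ℝ} (hM : M.PosSemidef) (v : m → ℝ) : 0 ≤ quad M v := by
  simpa [quad] using hM.dotProduct_mulVec_nonneg v

end Quadratic

/-! ### The loss as a distance to a subspace, and its measurability -/

section Loss

variable {d r : ℕ}

instance instBorelSpaceMatrix {m n : Type*} [Countable m] [Countable n] :
    BorelSpace (Matrix m n ℝ) :=
  inferInstanceAs (BorelSpace (m → n → ℝ))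

/-- The squared distance, in the norm of `M`, from `f` to the range of `R`. -/
def loss (M : Matrix (Fin d) (Fin d) ℝ) (R : Matrix (Fin d) (Fin r) ℝ) (f : Fin d → ℝ) : ℝ :=
  ⨅ q : Fin r → ℝ, quad M (f - R *ᵥ q)

variable {M : Matrix (Fin d) (Fin d) ℝ}

theorem bddBelow_quad {ι : Type*} (hM : M.PosSemidef) (v : ι → Fin d → ℝ) :
    BddBelow (Set.range fun i => quad M (v i)) :=
  ⟨0, by rintro _ ⟨i, rfl⟩; exact quad_nonneg hM _⟩

theorem loss_le (hM : M.PosSemidef) (R : Matrix (Fin d) (Fin r) ℝ) (f : Fin d → ℝ)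
    (q : Fin r → ℝ) : loss M R f ≤ quad M (f - R *ᵥ q) :=
  ciInf_le (bddBelow_quad hM _) q

theorem loss_nonneg (hM : M.PosSemidef) (R : Matrix (Fin d) (Fin r) ℝ) (f : Fin d → ℝ) :
    0 ≤ loss M R f :=
  le_ciInf fun _ => quad_nonneg hM _

theorem loss_le_quad (hM : M.PosSemidef) (R : Matrix (Fin d) (Fin r) ℝ) (f : Fin d → ℝ) :
    loss M R f ≤ quad M f := by
  simpa using loss_le hM R f 0

/-- The infimum is over uncountably many `q`, but an infimum of continuous functions is upper
semicontinuous, hence Borel. -/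
theorem measurable_loss_left (hM : M.PosSemidef) (f : Fin d → ℝ) :
    Measurable fun R : Matrix (Fin d) (Fin r) ℝ => loss M R f := by
  apply UpperSemicontinuous.measurable
  refine upperSemicontinuous_ciInf (fun R => bddBelow_quad hM _) fun q => ?_
  exact ((continuous_quad M).comp (by fun_prop)).upperSemicontinuous

theorem measurable_loss_right (hM : M.PosSemidef) (R : Matrix (Fin d) (Fin r) ℝ) :
    Measurable fun f : Fin d → ℝ => loss M R f := by
  apply UpperSemicontinuous.measurable
  refine upperSemicontinuous_ciInf (fun R => bddBelow_quad hM _) fun q => ?_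
  exact ((continuous_quad M).comp (by fun_prop)).upperSemicontinuous

theorem integrable_loss_left (hM : M.PosSemidef) (f : Fin d → ℝ)
    (μ : Measure (Matrix (Fin d) (Fin r) ℝ)) [IsProbabilityMeasure μ] :
    Integrable (fun R => loss M R f) μ :=
  Integrable.of_bound (measurable_loss_left hM f).aestronglyMeasurable (quad M f) <|
    .of_forall fun R => by
      rw [Real.norm_of_nonneg (loss_nonneg hM R f)]
      exact loss_le_quad hM R f

end Loss

/-! ### Reduction of the regret to the loss -/

section Regret

variable {Ω : Type*} [MeasurableSpace Ω] {d r : ℕ} {P : Measure Ω} [IsProbabilityMeasure P]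
  {x : Ω → Fin d → ℝ} {n : Ω → ℝ}

/-- Pull-out property: `E[x_i n | x] = x_i E[n | x] = 0`; then take expectations. -/
theorem integral_noise_mul_eq_zero (hx : Measurable x) (hx2 : MemLp x 2 P) (hn : MemLp n 2 P)
    (hnx : P[n | MeasurableSpace.comap x inferInstance] =ᵐ[P] 0) (i : Fin d) :
    ∫ ω, x ω i * n ω ∂P = 0 := by
  have hm := hx.comap_le
  have hsm : StronglyMeasurable[MeasurableSpace.comap x inferInstance] fun ω => x ω i :=
    ((measurable_pi_apply i).comp (comap_measurable x)).stronglyMeasurable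
  have hint : Integrable ((fun ω => x ω i) * n) P := (hx2.eval i).integrable_mul hn
  have h := condExp_mul_of_stronglyMeasurable_left hsm hint (hn.integrable one_le_two)
  rw [← integral_condExp hm (f := fun ω => x ω i * n ω)]
  apply integral_eq_zero_of_ae
  filter_upwards [h, hnx] with ω h1 h2
  refine h1.trans ?_
  simp [h2]

theorem integral_sq_dotProduct_add (hx : Measurable x) (hx2 : MemLp x 2 P) (hn : MemLp n 2 P)
    (hnx : P[n | MeasurableSpace.comap x inferInstance] =ᵐ[P] 0) (v : Fin d → ℝ) :
    ∫ ω, (v ⬝ᵥ x ω + n ω) ^ 2 ∂P = quad (secondMoment P x) v + ∫ ω, n ω ^ 2 ∂P := by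
  have hxx (i j : Fin d) : Integrable (fun ω => x ω i * x ω j) P :=
    (hx2.eval i).integrable_mul (hx2.eval j)
  have hxn (i : Fin d) : Integrable (fun ω => x ω i * n ω) P := (hx2.eval i).integrable_mul hn
  have hexp (ω : Ω) : (v ⬝ᵥ x ω + n ω) ^ 2 =
      ∑ i, ∑ j, v i * v j * (x ω i * x ω j) + ∑ i, 2 * v i * (x ω i * n ω) + n ω ^ 2 := by
    have h1 : (v ⬝ᵥ x ω) ^ 2 = ∑ i, ∑ j, v i * v j * (x ω i * x ω j) := by
      rw [sq, dotProduct, Finset.sum_mul_sum]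
      exact Finset.sum_congr rfl fun i _ => Finset.sum_congr rfl fun j _ => by ring
    have h2 : 2 * (v ⬝ᵥ x ω) * n ω = ∑ i, 2 * v i * (x ω i * n ω) := by
      rw [dotProduct, Finset.mul_sum, Finset.sum_mul]
      exact Finset.sum_congr rfl fun i _ => by ring
    rw [← h1, ← h2]; ring
  have i1 : Integrable (fun ω => ∑ i, ∑ j, v i * v j * (x ω i * x ω j)) P :=
    integrable_finsetSum _ fun i _ => integrable_finsetSum _ fun j _ => (hxx i j).const_mul _
  have i2 : Integrable (fun ω => ∑ i, 2 * v i * (x ω i * n ω)) P :=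
    integrable_finsetSum _ fun i _ => (hxn i).const_mul _
  have i3 : Integrable (fun ω => ∑ i, ∑ j, v i * v j * (x ω i * x ω j) +
      ∑ i, 2 * v i * (x ω i * n ω)) P := i1.add i2
  simp_rw [hexp]
  rw [integral_add i3 hn.integrable_sq, integral_add i1 i2,
    integral_finsetSum _ fun i _ => (hxn i).const_mul _,
    integral_finsetSum _ fun i _ => integrable_finsetSum _ fun j _ => (hxx i j).const_mul _]
  simp_rw [integral_const_mul, integral_noise_mul_eq_zero hx hx2 hn hnx]
  rw [quad_eq_sum]
  simp only [mul_zero, Finset.sum_const_zero, add_zero, add_left_inj]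
  refine Finset.sum_congr rfl fun i _ => ?_
  rw [integral_finsetSum _ fun j _ => (hxx i j).const_mul _]
  refine Finset.sum_congr rfl fun j _ => ?_
  rw [integral_const_mul, mul_comm]
  rfl

theorem minMSE_eq_loss_add (hx : Measurable x) (hx2 : MemLp x 2 P) (hn : MemLp n 2 P)
    (hnx : P[n | MeasurableSpace.comap x inferInstance] =ᵐ[P] 0)
    (hSig : (secondMoment P x).PosSemidef) (R : Matrix (Fin d) (Fin r) ℝ) (f : Fin d → ℝ) :
    minMSE P (fun ω => f ⬝ᵥ x ω + n ω) (fun ω => Rᵀ *ᵥ x ω) =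
      loss (secondMoment P x) R f + ∫ ω, n ω ^ 2 ∂P := by
  have h (q : Fin r → ℝ) : ∫ ω, (f ⬝ᵥ x ω + n ω - q ⬝ᵥ (Rᵀ *ᵥ x ω)) ^ 2 ∂P =
      quad (secondMoment P x) (f - R *ᵥ q) + ∫ ω, n ω ^ 2 ∂P := by
    rw [← integral_sq_dotProduct_add hx hx2 hn hnx]
    congr 1 with ω
    rw [sub_dotProduct, Matrix.dotProduct_mulVec q, Matrix.vecMul_transpose]
    ring
  simp_rw [minMSE, h, loss]
  exact (ciInf_add (bddBelow_quad hSig _) _).symm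

theorem regret_eq_loss (hx : Measurable x) (hx2 : MemLp x 2 P) (hn : MemLp n 2 P)
    (hnx : P[n | MeasurableSpace.comap x inferInstance] =ᵐ[P] 0)
    (hSig : (secondMoment P x).PosSemidef) (R : Matrix (Fin d) (Fin r) ℝ) (f : Fin d → ℝ) :
    regret P x n R f = loss (secondMoment P x) R f := by
  -- Prediction from `x` itself is the case `R = 1`, where `q = f` gives loss zero and only the
  -- noise variance remains.
  have h1 := minMSE_eq_loss_add hx hx2 hn hnx hSig (1 : Matrix (Fin d) (Fin d) ℝ) f
  have h0 : loss (secondMoment P x) (1 : Matrix (Fin d) (Fin d) ℝ) f = 0 :=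
    le_antisymm (by simpa [quad] using loss_le hSig (1 : Matrix (Fin d) (Fin d) ℝ) f f)
      (loss_nonneg hSig _ _)
  simp only [Matrix.transpose_one, Matrix.one_mulVec, h0] at h1
  rw [regret, minMSE_eq_loss_add hx hx2 hn hnx hSig, h1]
  ring

end Regret

/-! ### Expected quadratic forms -/

section SecondMoment

variable {d : ℕ} {π : Measure (Fin d → ℝ)}

theorem integral_quad (hπ : ∀ i j, Integrable (fun f : Fin d → ℝ => f i * f j) π)
    (M : Matrix (Fin d) (Fin d) ℝ) :
    ∫ f, quad M f ∂π = (Mᵀ * secondMoment π id).trace := by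
  have hM (i j : Fin d) : Integrable (fun f : Fin d → ℝ => M i j * (f i * f j)) π :=
    (hπ i j).const_mul _
  simp_rw [quad_eq_sum]
  rw [integral_finsetSum _ fun i _ => integrable_finsetSum _ fun j _ => hM i j, Matrix.trace]
  simp only [Matrix.diag, Matrix.mul_apply, Matrix.transpose_apply]
  rw [Finset.sum_comm]
  refine Finset.sum_congr rfl fun i _ => ?_
  rw [integral_finsetSum _ fun j _ => hM i j]
  refine Finset.sum_congr rfl fun j _ => ?_
  rw [integral_const_mul]
  rfl

end SecondMoment

/-! ### Matrix square roots -/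

section Sqrt

open scoped MatrixOrder

variable {d : ℕ} {M : Matrix (Fin d) (Fin d) ℝ}

theorem matSqrt_mul_self (hM : M.PosSemidef) : matSqrt M * matSqrt M = M :=
  CFC.sqrt_mul_sqrt_self M hM.nonneg

theorem transpose_matSqrt (M : Matrix (Fin d) (Fin d) ℝ) : (matSqrt M)ᵀ = matSqrt M := by
  have h : (matSqrt M).PosSemidef := Matrix.nonneg_iff_posSemidef.1 (CFC.sqrt_nonneg M)
  simpa using h.isHermitian.eq

theorem isUnit_det_matSqrt (hM : M.PosDef) : IsUnit (matSqrt M).det := by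
  have h := hM.det_pos
  rw [← matSqrt_mul_self hM.posSemidef, Matrix.det_mul] at h
  exact isUnit_iff_ne_zero.2 fun h0 => by simp [h0] at h

end Sqrt

/-! ### Sorted spectra of `Aᵀ A` and `A Aᵀ` -/

section Eigen

variable {d : ℕ} {M M' V V' : Matrix (Fin d) (Fin d) ℝ} {lam lam' : Fin d → ℝ}

theorem IsSortedEigendecomposition.pos (h : IsSortedEigendecomposition M lam V) (hM : M.PosDef)
    (i : Fin d) : 0 < lam i := by
  obtain ⟨-, hV, rfl⟩ := h
  have hVi : Function.Injective V.mulVec := fun a b hab => by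
    simpa [hV] using congrArg (Vᵀ *ᵥ ·) hab
  have h := hM.conjTranspose_mul_mul_same hVi
  have h2 : Vᴴ * (V * Matrix.diagonal lam * Vᵀ) * V = Matrix.diagonal lam := by
    calc Vᴴ * (V * Matrix.diagonal lam * Vᵀ) * V
        = (Vᵀ * V) * Matrix.diagonal lam * (Vᵀ * V) := by
          simp only [Matrix.conjTranspose_eq_transpose_of_trivial, Matrix.mul_assoc]
      _ = _ := by simp [hV]
  rw [h2] at h
  exact Matrix.posDef_diagonal_iff.1 h i

theorem IsSortedEigendecomposition.charpoly_eq (h : IsSortedEigendecomposition M lam V) :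
    M.charpoly = ∏ i, (Polynomial.X - Polynomial.C (lam i)) := by
  rw [h.2.2, Matrix.charpoly_mul_comm, ← mul_assoc, h.2.1, one_mul, Matrix.charpoly_diagonal]

/-- The roots of the characteristic polynomial determine the eigenvalues as a multiset, and sorting
leaves one ordering. This identifies the spectrum of an arbitrary decomposition `W` with that of
`V`. -/
theorem IsSortedEigendecomposition.eigenvalues_unique (h : IsSortedEigendecomposition M lam V)
    (h' : IsSortedEigendecomposition M' lam' V') (hc : M.charpoly = M'.charpoly) : lam = lam' := by
  have hroots (l : Fin d → ℝ) :
      (∏ i, (Polynomial.X - Polynomial.C (l i))).roots = (List.ofFn l : Multiset ℝ) := by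
    rw [Polynomial.roots_prod _ _ (Finset.prod_ne_zero_iff.2 fun i _ => Polynomial.X_sub_C_ne_zero _)]
    simp [List.ofFn_eq_map, Fin.univ_def]
  rw [h.charpoly_eq, h'.charpoly_eq] at hc
  have hp := congrArg Polynomial.roots hc
  rw [hroots, hroots, Multiset.coe_eq_coe] at hp
  exact List.ofFn_injective (hp.eq_of_sortedGE h.1.sortedGE_ofFn h'.1.sortedGE_ofFn)

/-- Singular value decomposition: the right singular vectors `V` of `A` yield the left ones `A V
Λ^{-1/2}`. -/
theorem IsSortedEigendecomposition.swap {A : Matrix (Fin d) (Fin d) ℝ}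
    (h : IsSortedEigendecomposition (Aᵀ * A) lam V) (hpos : ∀ i, 0 < lam i) :
    IsSortedEigendecomposition (A * Aᵀ) lam
      (A * V * Matrix.diagonal fun i => (√(lam i))⁻¹) := by
  obtain ⟨hanti, hV, hA⟩ := h
  have hs (i : Fin d) : √(lam i) * √(lam i) = lam i := Real.mul_self_sqrt (hpos i).le
  have hs0 (i : Fin d) : √(lam i) ≠ 0 := (Real.sqrt_pos.2 (hpos i)).ne'
  refine ⟨hanti, ?_, ?_⟩
  · calc _ = Matrix.diagonal (fun i => (√(lam i))⁻¹) * (Vᵀ * (Aᵀ * A) * V) *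
          Matrix.diagonal (fun i => (√(lam i))⁻¹) := by
          simp only [Matrix.transpose_mul, Matrix.diagonal_transpose, Matrix.mul_assoc]
      _ = Matrix.diagonal (fun i => (√(lam i))⁻¹) * ((Vᵀ * V) * Matrix.diagonal lam * (Vᵀ * V)) *
          Matrix.diagonal (fun i => (√(lam i))⁻¹) := by
          rw [hA]; simp only [Matrix.mul_assoc]
      _ = 1 := by
          rw [hV, one_mul, mul_one, Matrix.diagonal_mul_diagonal, Matrix.diagonal_mul_diagonal,
            ← Matrix.diagonal_one]
          congr 1 with i
          have := hs i; have := hs0 i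
          field_simp
          nlinarith
  · have h1 : (Matrix.diagonal fun i => (√(lam i))⁻¹) * Matrix.diagonal lam *
        (Matrix.diagonal fun i => (√(lam i))⁻¹) = (1 : Matrix (Fin d) (Fin d) ℝ) := by
      rw [Matrix.diagonal_mul_diagonal, Matrix.diagonal_mul_diagonal, ← Matrix.diagonal_one]
      congr 1 with i
      have := hs i; have := hs0 i
      field_simp
      nlinarith
    calc A * Aᵀ = A * (V * Vᵀ) * Aᵀ := by rw [mul_eq_one_comm.1 hV, mul_one]
      _ = A * V * ((Matrix.diagonal fun i => (√(lam i))⁻¹) * Matrix.diagonal lam *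
        (Matrix.diagonal fun i => (√(lam i))⁻¹)) * (Vᵀ * Aᵀ) := by
          rw [h1]; simp only [Matrix.mul_assoc, Matrix.one_mul]
      _ = _ := by
          simp only [Matrix.transpose_mul, Matrix.diagonal_transpose, Matrix.mul_assoc]

end Eigen

/-! ### Lower bound: what a rank-`r` representation must lose -/

section LowerBound

variable {d r : ℕ}

/-- The number `m` of basis vectors may be below `r`, since `B` may be rank deficient. -/
theorem exists_orthonormal_range (B : Matrix (Fin d) (Fin r) ℝ) :
    ∃ (m : ℕ) (E : Matrix (Fin d) (Fin m) ℝ), m ≤ r ∧ Eᵀ * E = 1 ∧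
      ∀ q, ∃ c, B *ᵥ q = E *ᵥ c := by
  let K := LinearMap.range (Matrix.toEuclideanLin B)
  let b := stdOrthonormalBasis ℝ K
  refine ⟨Module.finrank ℝ K, Matrix.of fun i k => (b k : EuclideanSpace ℝ (Fin d)) i, ?_, ?_, ?_⟩
  · simpa using LinearMap.finrank_range_le (Matrix.toEuclideanLin B)
  · ext k l
    have h := orthonormal_iff_ite.1 b.orthonormal l k
    rw [Submodule.coe_inner, EuclideanSpace.inner_eq_star_dotProduct] at h
    rw [Matrix.one_apply, if_congr (eq_comm (a := k)) rfl rfl, ← h]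
    rfl
  · intro q
    let y : K := ⟨Matrix.toEuclideanLin B (WithLp.toLp 2 q), LinearMap.mem_range_self _ _⟩
    refine ⟨fun k => b.repr y k, ?_⟩
    have h := congrArg (Subtype.val) (b.sum_repr y)
    ext i
    have h2 := congrArg (fun v : EuclideanSpace ℝ (Fin d) => v i) h
    simp only [Submodule.coe_sum, Submodule.coe_smul, WithLp.ofLp_sum, WithLp.ofLp_smul,
      Finset.sum_apply, Pi.smul_apply, smul_eq_mul] at h2
    have h3 : (y : EuclideanSpace ℝ (Fin d)) i = (B *ᵥ q) i := by simp [y]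
    rw [← h3, ← h2]
    exact Finset.sum_congr rfl fun k _ => mul_comm _ _

/-- Pythagoras: with `g = H f`, `|g - E c|² = |g|² - |Eᵀ g|² + |Eᵀ g - c|²`. The left side is now a
fixed quadratic form in `f`, whose expectation depends only on the second moment. -/
theorem quad_le_loss {m : ℕ} {H : Matrix (Fin d) (Fin d) ℝ} {R : Matrix (Fin d) (Fin r) ℝ}
    {E : Matrix (Fin d) (Fin m) ℝ} (hE : Eᵀ * E = 1) (hR : ∀ q, ∃ c, (H * R) *ᵥ q = E *ᵥ c)
    (f : Fin d → ℝ) : quad (Hᵀ * (1 - E * Eᵀ) * H) f ≤ loss (Hᵀ * H) R f := by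
  refine le_ciInf fun q => ?_
  obtain ⟨c, hc⟩ := hR q
  rw [quad_transpose_mul_mul, quad_transpose_mul, Matrix.mulVec_sub, Matrix.mulVec_mulVec, hc]
  generalize H *ᵥ f = g
  have h1 : quad (1 - E * Eᵀ) g = g ⬝ᵥ g - (Eᵀ *ᵥ g) ⬝ᵥ (Eᵀ *ᵥ g) := by
    have := quad_transpose_mul Eᵀ g
    rw [Matrix.transpose_transpose] at this
    rw [← this]
    simp [quad, Matrix.sub_mulVec]
  have h2 : (E *ᵥ c) ⬝ᵥ (E *ᵥ c) = c ⬝ᵥ c := by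
    rw [← quad_transpose_mul, hE]; simp [quad]
  have h3 : g ⬝ᵥ (E *ᵥ c) = (Eᵀ *ᵥ g) ⬝ᵥ c := by
    rw [Matrix.dotProduct_mulVec, Matrix.mulVec_transpose]
  have h4 : 0 ≤ (Eᵀ *ᵥ g - c) ⬝ᵥ (Eᵀ *ᵥ g - c) :=
    Finset.sum_nonneg fun i _ => mul_self_nonneg _
  rw [h1]
  simp only [sub_dotProduct, dotProduct_sub] at h4 ⊢
  rw [dotProduct_comm (E *ᵥ c) g, h2, h3]
  rw [dotProduct_comm c] at h4
  linarith

theorem trace_transpose_mul_self {m n : ℕ} (B : Matrix (Fin m) (Fin n) ℝ) :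
    (Bᵀ * B).trace = ∑ i, ∑ k, B i k ^ 2 := by
  rw [Matrix.trace, Finset.sum_comm]
  simp [Matrix.mul_apply, sq]

/-- In the basis `W` the trace is a sum of the `c i` weighted by the squared row norms of `Wᵀ E`.
These weights are nonnegative and add up to `m`. -/
theorem trace_projection_le {m : ℕ} {E : Matrix (Fin d) (Fin m) ℝ}
    {W : Matrix (Fin d) (Fin d) ℝ} (hE : Eᵀ * E = 1) (hW : Wᵀ * W = 1) {c : Fin d → ℝ}
    (hc : ∀ i, c i ≤ 1) : (E * Eᵀ * (W * Matrix.diagonal c * Wᵀ)).trace ≤ m := by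
  have h1 : (E * Eᵀ * (W * Matrix.diagonal c * Wᵀ)).trace =
      ∑ i, c i * ∑ k, (Wᵀ * E) i k ^ 2 := by
    calc _ = (Matrix.diagonal c * ((Wᵀ * E) * (Wᵀ * E)ᵀ)).trace := by
          rw [Matrix.trace_mul_comm, Matrix.mul_assoc, Matrix.mul_assoc, Matrix.trace_mul_comm]
          simp only [Matrix.transpose_mul, Matrix.transpose_transpose, Matrix.mul_assoc]
      _ = _ := by
          simp [Matrix.trace, -Matrix.transpose_mul, Matrix.diagonal_mul,
            Matrix.mul_apply (M := Wᵀ * E), sq]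
  have h2 : ∑ i, ∑ k, (Wᵀ * E) i k ^ 2 = m := by
    rw [← trace_transpose_mul_self]
    have : (Wᵀ * E)ᵀ * (Wᵀ * E) = Eᵀ * (W * Wᵀ) * E := by
      simp only [Matrix.transpose_mul, Matrix.transpose_transpose, Matrix.mul_assoc]
    rw [this, mul_eq_one_comm.1 hW, Matrix.mul_one, hE]
    simp
  rw [h1, ← h2]
  exact Finset.sum_le_sum fun i _ =>
    mul_le_of_le_one_left (Finset.sum_nonneg fun k _ => sq_nonneg _) (hc i)

theorem sum_indicator_lt {ℓ : ℕ} (hℓ : ℓ ≤ d) :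
    ∑ i : Fin d, (if i.val < ℓ then (1 : ℝ) else 0) = ℓ := by
  rw [Finset.sum_boole]
  simp [Fin.card_filter_val_lt, hℓ]

theorem le_integral_loss {H W : Matrix (Fin d) (Fin d) ℝ} {π : Measure (Fin d → ℝ)}
    (hπ : ∀ i j, Integrable (fun f : Fin d → ℝ => f i * f j) π) (hW : Wᵀ * W = 1) {ℓ : ℕ}
    (hℓ : ℓ ≤ d) {s : ℝ} (hs : 0 ≤ s)
    (hC : H * secondMoment π id * Hᵀ =
      s • (W * Matrix.diagonal (fun i : Fin d => if i.val < ℓ then (1 : ℝ) else 0) * Wᵀ))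
    (R : Matrix (Fin d) (Fin r) ℝ) (hint : Integrable (fun f => loss (Hᵀ * H) R f) π) :
    s * ((ℓ : ℝ) - r) ≤ ∫ f, loss (Hᵀ * H) R f ∂π := by
  obtain ⟨m, E, hm, hE, hR⟩ := exists_orthonormal_range (H * R)
  have hq : Integrable (fun f => quad (Hᵀ * (1 - E * Eᵀ) * H) f) π := by
    simp_rw [quad_eq_sum]
    exact integrable_finsetSum _ fun i _ => integrable_finsetSum _ fun j _ => (hπ i j).const_mul _
  refine le_trans ?_ (integral_mono hq hint fun f => quad_le_loss hE hR f)
  rw [integral_quad hπ]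
  set C := secondMoment π id
  set D := Matrix.diagonal (fun i : Fin d => if i.val < ℓ then (1 : ℝ) else 0)
  have h1 : ((Hᵀ * (1 - E * Eᵀ) * H)ᵀ * C).trace = ((1 - E * Eᵀ) * (H * C * Hᵀ)).trace := by
    simp only [Matrix.transpose_mul, Matrix.transpose_transpose, Matrix.transpose_sub,
      Matrix.transpose_one, Matrix.mul_assoc]
    rw [Matrix.trace_mul_comm]
    simp only [Matrix.mul_assoc]
  have h2 : (W * D * Wᵀ).trace = ℓ := by
    rw [Matrix.trace_mul_comm, ← Matrix.mul_assoc, hW, one_mul, Matrix.trace_diagonal,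
      sum_indicator_lt hℓ]
  have h3 := trace_projection_le hE hW
    (c := fun i : Fin d => if i.val < ℓ then (1 : ℝ) else 0) (fun i => by split_ifs <;> norm_num)
  rw [h1, hC, Matrix.mul_smul, Matrix.trace_smul, sub_mul, one_mul, Matrix.trace_sub, h2,
    smul_eq_mul]
  refine mul_le_mul_of_nonneg_left ?_ hs
  have : (m : ℝ) ≤ r := by exact_mod_cast hm
  linarith

/-- The weights `λ_i⁻¹` are absorbed into the normalised vectors `H S^{1/2} V Λ^{-1/2}`, so the
covariance of `H f` becomes isotropic on `ℓ` directions. This is the form required by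
`le_integral_loss`. -/
theorem conj_leastFavorableCov {H S V : Matrix (Fin d) (Fin d) ℝ} {lam : Fin d → ℝ}
    (hpos : ∀ i, 0 < lam i) (ℓ : ℕ) :
    H * leastFavorableCov S lam V ℓ * Hᵀ = (invSum lam ℓ)⁻¹ •
      ((H * matSqrt S * V * Matrix.diagonal fun i => (√(lam i))⁻¹) *
        Matrix.diagonal (fun i : Fin d => if i.val < ℓ then (1 : ℝ) else 0) *
        (H * matSqrt S * V * Matrix.diagonal fun i => (√(lam i))⁻¹)ᵀ) := by
  have h : Matrix.diagonal (fun i : Fin d => if i.val < ℓ then (lam i)⁻¹ else 0) =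
      (Matrix.diagonal fun i => (√(lam i))⁻¹) *
        Matrix.diagonal (fun i : Fin d => if i.val < ℓ then (1 : ℝ) else 0) *
        (Matrix.diagonal fun i => (√(lam i))⁻¹) := by
    rw [Matrix.diagonal_mul_diagonal, Matrix.diagonal_mul_diagonal]
    congr 1 with i
    split_ifs
    · rw [mul_one, ← mul_inv, Real.mul_self_sqrt (hpos i).le]
    · simp
  rw [leastFavorableCov, h]
  simp only [Matrix.transpose_mul, Matrix.diagonal_transpose, Matrix.mul_smul, Matrix.smul_mul,
    Matrix.mul_assoc, transpose_matSqrt]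

end LowerBound

/-! ### Upper bound: the cost of keeping the eigenvectors in `I` -/

section UpperBound

variable {d r : ℕ}

/-- Inverting `H S H = W Λ Wᵀ` gives `S⁻¹ = H W Λ⁻¹ Wᵀ H`. -/
theorem sum_inv_mul_sq_eq {H S W : Matrix (Fin d) (Fin d) ℝ} {lam : Fin d → ℝ}
    (hH : Hᵀ = H) (hHu : IsUnit H.det) (hW : IsSortedEigendecomposition (H * S * H) lam W)
    (hpos : ∀ i, 0 < lam i) (f : Fin d → ℝ) :
    ∑ i, (lam i)⁻¹ * (Wᵀ *ᵥ (H *ᵥ f)) i ^ 2 = quad S⁻¹ f := by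
  have hWW := hW.2.1
  have hinv : S⁻¹ = (Wᵀ * H)ᵀ * Matrix.diagonal (fun i => (lam i)⁻¹) * (Wᵀ * H) := by
    refine Matrix.inv_eq_left_inv ?_
    have hd : Matrix.diagonal (fun i => (lam i)⁻¹) * Matrix.diagonal lam = 1 := by
      rw [Matrix.diagonal_mul_diagonal, ← Matrix.diagonal_one]
      congr 1 with i
      exact inv_mul_cancel₀ (hpos i).ne'
    calc _ = H * W * Matrix.diagonal (fun i => (lam i)⁻¹) * Wᵀ * (H * S * H) * H⁻¹ := by
          simp only [Matrix.transpose_mul, Matrix.transpose_transpose, hH, Matrix.mul_assoc,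
            Matrix.mul_nonsing_inv _ hHu, Matrix.mul_one]
      _ = H * W * (Matrix.diagonal (fun i => (lam i)⁻¹) * (Wᵀ * W) * Matrix.diagonal lam) * Wᵀ *
          H⁻¹ := by rw [hW.2.2]; simp only [Matrix.mul_assoc]
      _ = H * (W * Wᵀ) * H⁻¹ := by
          rw [hWW, mul_one, hd]; simp only [Matrix.mul_assoc, Matrix.one_mul]
      _ = 1 := by rw [mul_eq_one_comm.1 hWW, mul_one, Matrix.mul_nonsing_inv _ hHu]
  rw [hinv, quad_transpose_mul_mul, quad_diagonal, Matrix.mulVec_mulVec]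

theorem dotProduct_self_orthogonal {W : Matrix (Fin d) (Fin d) ℝ} (hW : Wᵀ * W = 1)
    (a : Fin d → ℝ) : (W *ᵥ a) ⬝ᵥ (W *ᵥ a) = ∑ i, a i ^ 2 := by
  rw [← quad_transpose_mul, hW]
  simp [quad, dotProduct, sq]

theorem colSubset_mulVec {ℓ : ℕ} (hℓ : ℓ ≤ d) (W : Matrix (Fin d) (Fin d) ℝ) (I : RSubset ℓ r)
    (a : Fin d → ℝ) :
    colSubset hℓ W I *ᵥ (fun k => a (Fin.castLE hℓ (I.1.orderEmbOfFin I.2 k))) =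
      W *ᵥ (fun i => if i ∈ I.1.map (Fin.castLEEmb hℓ) then a i else 0) := by
  ext t
  simp only [Matrix.mulVec, dotProduct, mul_ite, mul_zero, Finset.sum_ite_mem, Finset.univ_inter,
    Finset.sum_map]
  have h (g : Fin ℓ → ℝ) : ∑ k, g (I.1.orderEmbOfFin I.2 k) = ∑ j ∈ I.1, g j := by
    conv_rhs => rw [← Finset.map_orderEmbOfFin_univ I.1 I.2, Finset.sum_map]
    rfl
  exact h fun j => W t (Fin.castLE hℓ j) * a (Fin.castLE hℓ j)

theorem loss_colSubset_le {ℓ : ℕ} (hℓ : ℓ ≤ d) {H W : Matrix (Fin d) (Fin d) ℝ}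
    (hHu : IsUnit H.det) (hW : Wᵀ * W = 1) (hP : (Hᵀ * H).PosSemidef) (I : RSubset ℓ r)
    (f : Fin d → ℝ) :
    loss (Hᵀ * H) (H⁻¹ * colSubset hℓ W I) f ≤
      ∑ i, (if i ∈ I.1.map (Fin.castLEEmb hℓ) then 0 else 1) * (Wᵀ *ᵥ (H *ᵥ f)) i ^ 2 := by
  set a := Wᵀ *ᵥ (H *ᵥ f) with ha
  -- The chosen `q` reproduces the coordinates of `H f` along the columns in `I`, leaving the others
  -- as error.
  refine (loss_le hP _ f fun k => a (Fin.castLE hℓ (I.1.orderEmbOfFin I.2 k))).trans_eq ?_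
  rw [quad_transpose_mul, Matrix.mulVec_sub, Matrix.mulVec_mulVec, ← Matrix.mul_assoc,
    Matrix.mul_nonsing_inv _ hHu, Matrix.one_mul, colSubset_mulVec]
  have hg : H *ᵥ f = W *ᵥ a := by
    rw [ha, Matrix.mulVec_mulVec, mul_eq_one_comm.1 hW, Matrix.one_mulVec]
  rw [hg, ← Matrix.mulVec_sub, dotProduct_self_orthogonal hW]
  refine Finset.sum_congr rfl fun i _ => ?_
  by_cases h : i ∈ I.1.map (Fin.castLEEmb hℓ) <;> simp only [Pi.sub_apply, h, if_true, if_false] <;> ring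

end UpperBound

/-! ### The effective dimension `ℓ` and its two inequalities -/

section EffectiveDim

variable {d r : ℕ} {lam : Fin d → ℝ}

theorem invSum_eq {ℓ : ℕ} (hℓ : ℓ ≤ d) :
    invSum lam ℓ = ∑ j : Fin ℓ, (lam (Fin.castLE hℓ j))⁻¹ := by
  have h : (Finset.univ.filter fun i : Fin d => i.val < ℓ) =
      Finset.univ.map (Fin.castLEEmb hℓ) := by
    ext i
    simp only [Finset.mem_filter, Finset.mem_univ, true_and, Finset.mem_map]
    exact ⟨fun h => ⟨⟨i, h⟩, rfl⟩, by rintro ⟨j, rfl⟩; exact j.2⟩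
  rw [invSum, h, Finset.sum_map]
  rfl

theorem invSum_succ {ℓ : ℕ} (hℓ : ℓ < d) : invSum lam (ℓ + 1) = invSum lam ℓ + (lam ⟨ℓ, hℓ⟩)⁻¹ := by
  rw [invSum_eq (Nat.succ_le_of_lt hℓ), invSum_eq hℓ.le, Fin.sum_univ_castSucc]
  rfl

theorem invSum_pos (hpos : ∀ i, 0 < lam i) {ℓ : ℕ} (hℓ : ℓ ≤ d) (h0 : 0 < ℓ) :
    0 < invSum lam ℓ := by
  rw [invSum_eq hℓ]
  have : Nonempty (Fin ℓ) := ⟨⟨0, h0⟩⟩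
  exact Finset.sum_pos (fun i _ => inv_pos.2 (hpos _)) Finset.univ_nonempty

theorem exists_isEffectiveDim (hr : r < d) (hpos : ∀ i, 0 < lam i) :
    ∃ ℓ, IsEffectiveDim r lam ℓ := by
  -- Here `ℓ = r + k + 1`, and `p k` is the first inequality at `ℓ`. The largest such `k` works:
  -- subtracting `λ_{ℓ+1}⁻¹` from both sides of the first inequality at `ℓ + 1` shows that its
  -- failure gives the second one at `ℓ`.
  let p : ℕ → Prop := fun k => ∃ h : r + k < d,
    ((r + k + 1 : ℕ) - r : ℝ) * (lam ⟨r + k, h⟩)⁻¹ ≤ invSum lam (r + k + 1)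
  have h0 : p 0 := by
    refine ⟨hr, ?_⟩
    rw [invSum_succ (ℓ := r + 0) hr]
    have : 0 ≤ invSum lam (r + 0) := Finset.sum_nonneg fun i _ => (inv_pos.2 (hpos i)).le
    push_cast
    linarith
  classical
  let k := Nat.findGreatest p d
  obtain ⟨hk, hle⟩ : p k := Nat.findGreatest_spec (Nat.zero_le d) h0
  refine ⟨r + k + 1, by omega, by omega, ?_, ?_⟩
  · intro i hi
    obtain rfl : i = ⟨r + k, hk⟩ := Fin.ext (by simpa using hi)
    exact hle
  · intro i hi
    by_contra! hlt
    have hd : r + (k + 1) < d := by have := i.2; omega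
    obtain rfl : i = ⟨r + (k + 1), hd⟩ := Fin.ext hi
    have hp : p (k + 1) := by
      refine ⟨hd, ?_⟩
      rw [invSum_succ hd]
      push_cast at hlt ⊢
      have e : invSum lam (r + (k + 1)) = invSum lam (r + k + 1) := rfl
      linarith
    have := Nat.le_findGreatest (P := p) (n := d) (m := k + 1) (by omega) hp
    have : k + 1 ≤ k := this
    omega

theorem sum_bVec (hpos : ∀ i, 0 < lam i) {ℓ : ℕ} (hℓ : ℓ ≤ d) (h0 : 0 < ℓ) :
    ∑ j, bVec r lam hℓ j = (ℓ : ℝ) - r := by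
  unfold bVec
  rw [← Finset.mul_sum, ← Finset.sum_div, ← invSum_eq, div_self (invSum_pos hpos hℓ h0).ne',
    mul_one]

theorem IsEffectiveDim.bVec_mem_Icc (hanti : Antitone lam) (hpos : ∀ i, 0 < lam i) {ℓ : ℕ}
    (h : IsEffectiveDim r lam ℓ) (hℓ : ℓ ≤ d) (j : Fin ℓ) :
    bVec r lam hℓ j ∈ Set.Icc (0 : ℝ) 1 := by
  obtain ⟨hr, -, h1, -⟩ := h
  have hs := invSum_pos hpos hℓ (by omega)
  have hlr : (0 : ℝ) < ℓ - r := sub_pos.2 (by exact_mod_cast hr)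
  refine ⟨mul_nonneg hlr.le (div_nonneg (inv_pos.2 (hpos _)).le hs.le), ?_⟩
  rw [bVec, ← mul_div_assoc, div_le_one hs]
  -- The inverse eigenvalues increase, so the last entry is the largest, and the first inequality
  -- bounds exactly that one.
  refine le_trans ?_ (h1 ⟨ℓ - 1, by omega⟩ (by simp only; omega))
  refine mul_le_mul_of_nonneg_left (inv_anti₀ (hpos _) (hanti ?_)) hlr.le
  have := j.2
  exact Fin.mk_le_mk.2 (by omega)

theorem incidence_col_sum {ℓ : ℕ} (I : RSubset ℓ r) : ∑ j, incidence ℓ r j I = (ℓ : ℝ) - r := by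
  have h : ∀ j, incidence ℓ r j I = 1 - if j ∈ I.1 then 1 else 0 := fun j => by
    simp only [incidence, Matrix.of_apply]; split_ifs <;> norm_num
  simp_rw [h]
  simp [Finset.sum_sub_distrib, I.2]

/-- Add up the rows of `Ā p = b̄`: each column of `Ā` sums to `ℓ - r`, and so does `b̄`. -/
theorem IsWeightVector.sum_eq_one (hpos : ∀ i, 0 < lam i) {ℓ : ℕ} {hℓ : ℓ ≤ d} (hr : r < ℓ)
    {p : RSubset ℓ r → ℝ} (hp : IsWeightVector r lam hℓ p) : ∑ I, p I = 1 := by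
  have h := sum_bVec (r := r) hpos hℓ (by omega)
  rw [← hp.2] at h
  simp only [Matrix.mulVec, dotProduct] at h
  rw [Finset.sum_comm] at h
  simp_rw [← Finset.sum_mul, incidence_col_sum, ← Finset.mul_sum] at h
  have hlr : (0 : ℝ) < ℓ - r := sub_pos.2 (by exact_mod_cast hr)
  exact mul_left_cancel₀ hlr.ne' (by rw [h, mul_one])

theorem IsWeightVector.sum_notMem_le (hanti : Antitone lam) (hpos : ∀ i, 0 < lam i) {ℓ : ℕ}
    {hℓ : ℓ ≤ d} (h : IsEffectiveDim r lam ℓ) {p : RSubset ℓ r → ℝ}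
    (hp : IsWeightVector r lam hℓ p) (i : Fin d) :
    ∑ I, p I * (if i ∈ I.1.map (Fin.castLEEmb hℓ) then 0 else 1) ≤
      ((ℓ : ℝ) - r) / invSum lam ℓ * (lam i)⁻¹ := by
  have hs := invSum_pos hpos hℓ (by have := h.1; omega)
  have hlr : (0 : ℝ) < ℓ - r := sub_pos.2 (by exact_mod_cast h.1)
  by_cases hi : i.val < ℓ
  · obtain ⟨j, rfl⟩ : ∃ j : Fin ℓ, i = Fin.castLEEmb hℓ j := ⟨⟨i, hi⟩, rfl⟩
    have hb := congrFun hp.2 j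
    simp only [Matrix.mulVec, dotProduct, incidence, Matrix.of_apply, bVec] at hb
    simp_rw [Finset.mem_map', mul_comm (p _), hb]
    exact le_of_eq (by rw [Fin.castLEEmb_apply]; ring)
  -- Directions beyond `ℓ` are never represented, so their coefficient is 1; the second inequality
  -- makes this affordable.
  · have hn (I : RSubset ℓ r) : i ∉ I.1.map (Fin.castLEEmb hℓ) := by
      rw [Finset.mem_map]
      rintro ⟨j, -, rfl⟩
      exact hi j.2
    simp only [hn, if_false, mul_one, hp.sum_eq_one hpos h.1]
    rw [div_mul_eq_mul_div, one_le_div hs]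
    refine (h.2.2.2 ⟨ℓ, by have := i.2; omega⟩ rfl).trans ?_
    exact mul_le_mul_of_nonneg_left (inv_anti₀ (hpos _) (hanti (Fin.mk_le_of_le_val (by omega))))
      hlr.le

theorem IsWeightVector.sum_loss_le {H S W : Matrix (Fin d) (Fin d) ℝ} (hH : Hᵀ = H)
    (hHu : IsUnit H.det) (hP : (Hᵀ * H).PosSemidef)
    (hW : IsSortedEigendecomposition (H * S * H) lam W) (hpos : ∀ i, 0 < lam i) {ℓ : ℕ}
    {hℓ : ℓ ≤ d} (h : IsEffectiveDim r lam ℓ) {p : RSubset ℓ r → ℝ}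
    (hp : IsWeightVector r lam hℓ p) (f : Fin d → ℝ) :
    ∑ I, p I * loss (Hᵀ * H) (H⁻¹ * colSubset hℓ W I) f ≤
      ((ℓ : ℝ) - r) / invSum lam ℓ * quad S⁻¹ f := by
  refine (Finset.sum_le_sum fun I _ => mul_le_mul_of_nonneg_left
    (loss_colSubset_le hℓ hHu hW.2.1 hP I f) (hp.1 I).1).trans ?_
  simp_rw [← sum_inv_mul_sq_eq hH hHu hW hpos f, Finset.mul_sum]
  rw [Finset.sum_comm]
  refine Finset.sum_le_sum fun i _ => ?_
  simp_rw [← mul_assoc, ← Finset.sum_mul]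
  exact mul_le_mul_of_nonneg_right (hp.sum_notMem_le hW.1 hpos h i) (sq_nonneg _)

end EffectiveDim

/-! ### Existence of sparse weights: Birkhoff and Carathéodory -/

section Weights

variable {d r : ℕ}

theorem mem_convexHull_incidence {ℓ : ℕ} (hr : r < ℓ) {b : Fin ℓ → ℝ}
    (hb : ∀ i, b i ∈ Set.Icc (0 : ℝ) 1) (hsum : ∑ i, b i = (ℓ : ℝ) - r) :
    b ∈ convexHull ℝ (Set.range (incidence ℓ r).col) := by
  have hlr : (0 : ℝ) < ℓ - r := sub_pos.2 (by exact_mod_cast hr)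
  have hone : ∀ i, (r : ℝ) * ((1 - b i) / r) = 1 - b i := by
    intro i
    -- For `r = 0` the quotient is zero by convention; the identity survives because `∑ b i = ℓ`
    -- with `b i ≤ 1` forces `b i = 1`.
    rcases Nat.eq_zero_or_pos r with rfl | h
    · have h0 : ∑ i, (1 - b i) = 0 := by simp [Finset.sum_sub_distrib, hsum]
      have := (Finset.sum_eq_zero_iff_of_nonneg fun i _ => sub_nonneg.2 (hb i).2).1 h0 i
        (Finset.mem_univ i)
      simp [this]
    · have : (r : ℝ) ≠ 0 := by positivity
      field_simp
  have hcard : ∑ j : Fin ℓ, (if j.val < r then (1 : ℝ) else 0) = r := sum_indicator_lt hr.le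
  have hcard' : ∑ j : Fin ℓ, (if j.val < r then (0 : ℝ) else 1) = ℓ - r := by
    have h (j : Fin ℓ) : (if j.val < r then (0 : ℝ) else 1) = 1 - if j.val < r then 1 else 0 := by
      split_ifs <;> norm_num
    simp_rw [h, Finset.sum_sub_distrib, hcard]
    simp
  -- Spread `1 - b` evenly over `r` columns and `b` over the other `ℓ - r`. The result is doubly
  -- stochastic, and summing its last `ℓ - r` columns recovers `b`.
  let M : Matrix (Fin ℓ) (Fin ℓ) ℝ :=
    Matrix.of fun i j => if j.val < r then (1 - b i) / r else b i / (ℓ - r)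
  have hM : M ∈ doublyStochastic ℝ (Fin ℓ) := by
    rw [mem_doublyStochastic_iff_sum]
    refine ⟨fun i j => ?_, fun i => ?_, fun j => ?_⟩
    · simp only [M, Matrix.of_apply]
      split_ifs
      · exact div_nonneg (sub_nonneg.2 (hb i).2) (Nat.cast_nonneg r)
      · exact div_nonneg (hb i).1 hlr.le
    · have h (j : Fin ℓ) : M i j = (if j.val < r then 1 else 0) * ((1 - b i) / r) +
          (if j.val < r then 0 else 1) * (b i / (ℓ - r)) := by
        simp only [M, Matrix.of_apply]; split_ifs <;> ring
      simp_rw [h, Finset.sum_add_distrib, ← Finset.sum_mul, hcard, hcard', hone]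
      field_simp
      ring
    · simp only [M, Matrix.of_apply]
      split_ifs with h
      · have : (r : ℝ) ≠ 0 := by
          have : 0 < r := by omega
          positivity
        rw [← Finset.sum_div, Finset.sum_sub_distrib, hsum]
        simp [this]
      · rw [← Finset.sum_div, hsum, div_self hlr.ne']
  let L : Matrix (Fin ℓ) (Fin ℓ) ℝ →ₗ[ℝ] (Fin ℓ → ℝ) :=
    Matrix.mulVecBilin ℝ ℝ |>.flip fun j : Fin ℓ => if j.val < r then (0 : ℝ) else 1
  have hL (A : Matrix (Fin ℓ) (Fin ℓ) ℝ) (i : Fin ℓ) :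
      L A i = ∑ j, A i j * if j.val < r then (0 : ℝ) else 1 := rfl
  have hLM : L M = b := by
    ext i
    have h (j : Fin ℓ) : M i j * (if j.val < r then (0 : ℝ) else 1) =
        (if j.val < r then 0 else 1) * (b i / (ℓ - r)) := by
      simp only [M, Matrix.of_apply]; split_ifs <;> ring
    simp_rw [hL, h, ← Finset.sum_mul, hcard']
    field_simp
  have hmem : M ∈ convexHull ℝ {A | ∃ σ : Equiv.Perm (Fin ℓ), σ.permMatrix ℝ = A} := by
    rw [← doublyStochastic_eq_convexHull_permMatrix]; exact hM
  have himg := Set.mem_image_of_mem L hmem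
  rw [LinearMap.image_convexHull, hLM] at himg
  refine convexHull_mono ?_ himg
  rintro _ ⟨_, ⟨σ, rfl⟩, rfl⟩
  -- Summing the last `ℓ - r` columns of a permutation matrix gives a 0/1 vector whose zeros are the
  -- `r` rows that `σ` sends to the first `r` columns.
  let J : Finset (Fin ℓ) := Finset.univ.filter fun i => (σ i).val < r
  have hJ : J.card = r := by
    have h : J = (Finset.univ.filter fun j : Fin ℓ => j.val < r).map σ.symm.toEmbedding := by
      ext i
      simp [J]
    rw [h, Finset.card_map]
    simp [Fin.card_filter_val_lt, hr.le]
  refine ⟨⟨J, hJ⟩, ?_⟩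
  ext i
  have hσ (j : Fin ℓ) : σ.permMatrix ℝ i j = if j = σ i then 1 else 0 := by
    simp [Equiv.Perm.permMatrix, PEquiv.toMatrix_apply, eq_comm]
  simp_rw [hL, hσ, ite_mul, one_mul, zero_mul]
  simp [incidence, J]

theorem exists_sparse_of_mem_convexHull {ℓ : ℕ} {κ : Type*} [Fintype κ] {A : Matrix (Fin ℓ) κ ℝ}
    {b : Fin ℓ → ℝ} (hb : b ∈ convexHull ℝ (Set.range A.col)) :
    ∃ p : κ → ℝ, (∀ k, p k ∈ Set.Icc (0 : ℝ) 1) ∧ A *ᵥ p = b ∧ {k | p k ≠ 0}.ncard ≤ ℓ + 1 := by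
  classical
  obtain ⟨ι, _, z, w, hz, hind, hw, hw1, hwz⟩ := eq_pos_convex_span_of_mem_convexHull hb
  have hz' (i : ι) : ∃ k, A.col k = z i := hz (Set.mem_range_self i)
  choose k hk using hz'
  -- Summing over the fibres of `k` avoids having to show that `k` is injective. The affine
  -- independence of the points in `ℝ^ℓ` bounds their number by `ℓ + 1`.
  refine ⟨fun j => ∑ i with k i = j, w i, fun j => ⟨?_, ?_⟩, ?_, ?_⟩
  · exact Finset.sum_nonneg fun i _ => (hw i).le
  · rw [← hw1]
    exact Finset.sum_le_sum_of_subset_of_nonneg (Finset.filter_subset _ _) fun i _ _ => (hw i).le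
  · ext t
    rw [← hwz]
    simp only [Matrix.mulVec, dotProduct, Finset.sum_apply, Pi.smul_apply, smul_eq_mul, ← hk,
      Matrix.col_apply, Finset.mul_sum, Finset.sum_filter]
    rw [Finset.sum_comm]
    simp [mul_comm]
  · have hsub : {j | ∑ i with k i = j, w i ≠ 0} ⊆ Set.range k := by
      intro j hj
      obtain ⟨i, hi, -⟩ := Finset.exists_ne_zero_of_sum_ne_zero hj
      exact ⟨i, (Finset.mem_filter.1 hi).2⟩
    calc _ ≤ (Set.range k).ncard := Set.ncard_le_ncard hsub (Set.toFinite _)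
      _ ≤ Fintype.card ι := by
        rw [← Set.image_univ, ← Nat.card_eq_fintype_card, ← Set.ncard_univ]
        exact Set.ncard_image_le (Set.toFinite _)
      _ ≤ Module.finrank ℝ (vectorSpan ℝ (Set.range z)) + 1 := hind.card_le_finrank_succ
      _ ≤ ℓ + 1 := by
        have := Submodule.finrank_le (vectorSpan ℝ (Set.range z))
        simpa using this

theorem exists_isWeightVector {lam : Fin d → ℝ} (hanti : Antitone lam) (hpos : ∀ i, 0 < lam i)
    {ℓ : ℕ} (h : IsEffectiveDim r lam ℓ) (hℓ : ℓ ≤ d) :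
    ∃ p : RSubset ℓ r → ℝ, IsWeightVector r lam hℓ p ∧ {I | p I ≠ 0}.ncard ≤ ℓ + 1 := by
  obtain ⟨p, hp, hA, hc⟩ := exists_sparse_of_mem_convexHull (mem_convexHull_incidence h.1
    (h.bVec_mem_Icc hanti hpos hℓ) (sum_bVec hpos hℓ (by have := h.1; omega)))
  exact ⟨p, ⟨hp, hA⟩, hc⟩

end Weights

/-! ### Finitely supported laws -/

section FiniteSupport

variable {ι α : Type*} [Fintype ι] [MeasurableSpace α]

theorem integral_sum_smul_dirac [MeasurableSingletonClass α] {E : Type*} [NormedAddCommGroup E]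
    [NormedSpace ℝ E] [CompleteSpace E] {c : ι → ℝ} (hc : ∀ i, 0 ≤ c i) (a : ι → α) (g : α → E) :
    ∫ y, g y ∂(∑ i, ENNReal.ofReal (c i) • Measure.dirac (a i)) = ∑ i, c i • g (a i) := by
  rw [integral_finsetSum_measure fun i _ =>
    (integrable_dirac (by simp)).smul_measure ENNReal.ofReal_ne_top]
  refine Finset.sum_congr rfl fun i _ => ?_
  rw [integral_smul_measure, integral_dirac, ENNReal.toReal_ofReal (hc i)]

theorem isProbabilityMeasure_sum_smul_dirac {c : ι → ℝ} (hc : ∀ i, 0 ≤ c i) (h1 : ∑ i, c i = 1)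
    (a : ι → α) :
    IsProbabilityMeasure (∑ i, ENNReal.ofReal (c i) • Measure.dirac (a i)) := by
  refine ⟨?_⟩
  simp [Measure.finsetSum_apply, ← ENNReal.ofReal_sum_of_nonneg fun i _ => hc i, h1]

theorem ae_sum_smul_dirac [MeasurableSingletonClass α] (c : ι → ℝ) {a : ι → α} {s : Set α} (ha : ∀ i, a i ∈ s) :
    ∀ᵐ y ∂(∑ i, ENNReal.ofReal (c i) • Measure.dirac (a i)), y ∈ s := by
  rw [ae_iff, Measure.finsetSum_apply]
  refine Finset.sum_eq_zero fun i _ => ?_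
  simp [ha i]

end FiniteSupport

/-! ### Priors on the ellipsoid and an explicit least favorable one -/

section Prior

variable {d r : ℕ} {S V : Matrix (Fin d) (Fin d) ℝ} {lam : Fin d → ℝ} {π : Measure (Fin d → ℝ)}

theorem inv_eq_transpose_mul_self (hS : S.PosDef) : S⁻¹ = ((matSqrt S)⁻¹)ᵀ * (matSqrt S)⁻¹ := by
  rw [Matrix.transpose_nonsing_inv, transpose_matSqrt, ← Matrix.mul_inv_rev,
    matSqrt_mul_self hS.posSemidef]

/-- The ellipsoid is the image of the unit ball under `S^{1/2}`. Its boundedness is the source of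
every integrability statement about priors. -/
theorem exists_bound_ellipsoid (hS : S.PosDef) : ∃ C, ∀ f ∈ ellipsoid S, ∀ i, |f i| ≤ C := by
  set G := matSqrt S with hG
  refine ⟨∑ i, ∑ j, |G i j|, fun f hf i => ?_⟩
  have hk : ∀ j, |(G⁻¹ *ᵥ f) j| ≤ 1 := by
    intro j
    have h : quad S⁻¹ f ≤ 1 := hf
    rw [inv_eq_transpose_mul_self hS, quad_transpose_mul] at h
    rw [← sq_le_one_iff_abs_le_one, sq]
    refine le_trans ?_ h
    exact Finset.single_le_sum (f := fun j => (G⁻¹ *ᵥ f) j * (G⁻¹ *ᵥ f) j)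
      (fun j _ => mul_self_nonneg _) (Finset.mem_univ j)
  have hf' : f = G *ᵥ (G⁻¹ *ᵥ f) := by
    rw [Matrix.mulVec_mulVec, Matrix.mul_nonsing_inv _ (isUnit_det_matSqrt hS), Matrix.one_mulVec]
  calc |f i| = |∑ j, G i j * (G⁻¹ *ᵥ f) j| := congrArg (|· i|) hf'
    _ ≤ ∑ j, |G i j| := (Finset.abs_sum_le_sum_abs _ _).trans <| Finset.sum_le_sum fun j _ => by
        rw [abs_mul]
        exact mul_le_of_le_one_right (abs_nonneg _) (hk j)
    _ ≤ _ := Finset.single_le_sum (f := fun i => ∑ j, |G i j|)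
        (fun i _ => Finset.sum_nonneg fun j _ => abs_nonneg _) (Finset.mem_univ i)

theorem exists_quad_bound_ellipsoid (hS : S.PosDef) (M : Matrix (Fin d) (Fin d) ℝ) :
    ∃ C, ∀ f ∈ ellipsoid S, quad M f ≤ C := by
  obtain ⟨C, hC⟩ := exists_bound_ellipsoid hS
  refine ⟨∑ i, ∑ j, |M i j| * (C * C), fun f hf => ?_⟩
  rw [quad_eq_sum]
  refine Finset.sum_le_sum fun i _ => Finset.sum_le_sum fun j _ => (le_abs_self _).trans ?_
  rw [abs_mul, abs_mul]
  exact mul_le_mul_of_nonneg_left (mul_le_mul (hC f hf i) (hC f hf j) (abs_nonneg _)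
    ((abs_nonneg _).trans (hC f hf i))) (abs_nonneg _)

theorem IsPrior.integrable_mul (hπ : IsPrior S π) (hS : S.PosDef) (i j : Fin d) :
    Integrable (fun f : Fin d → ℝ => f i * f j) π := by
  have := hπ.1
  obtain ⟨C, hC⟩ := exists_bound_ellipsoid hS
  refine Integrable.of_bound (by fun_prop) (C * C) ?_
  filter_upwards [hπ.2] with f hf
  rw [Real.norm_eq_abs, abs_mul]
  exact mul_le_mul (hC f hf i) (hC f hf j) (abs_nonneg _) ((abs_nonneg _).trans (hC f hf i))

theorem IsPrior.integrable_loss (hπ : IsPrior S π) (hS : S.PosDef)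
    {M : Matrix (Fin d) (Fin d) ℝ} (hM : M.PosSemidef) (R : Matrix (Fin d) (Fin r) ℝ) :
    Integrable (fun f => loss M R f) π := by
  have := hπ.1
  obtain ⟨C, hC⟩ := exists_quad_bound_ellipsoid hS M
  refine Integrable.of_bound (measurable_loss_right hM R).aestronglyMeasurable C ?_
  filter_upwards [hπ.2] with f hf
  rw [Real.norm_of_nonneg (loss_nonneg hM R f)]
  exact (loss_le_quad hM R f).trans (hC f hf)

/-- The weight of the `k`-th principal direction under the least favorable prior. -/
def atomWeight (lam : Fin d → ℝ) (ℓ : ℕ) (k : Fin d) : ℝ :=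
  (invSum lam ℓ)⁻¹ * if k.val < ℓ then (lam k)⁻¹ else 0

theorem atomWeight_nonneg (hpos : ∀ i, 0 < lam i) (ℓ : ℕ) (k : Fin d) :
    0 ≤ atomWeight lam ℓ k := by
  refine mul_nonneg (inv_nonneg.2 (Finset.sum_nonneg fun i _ => (inv_pos.2 (hpos i)).le)) ?_
  split_ifs
  · exact (inv_pos.2 (hpos k)).le
  · exact le_rfl

theorem sum_atomWeight (hpos : ∀ i, 0 < lam i) {ℓ : ℕ} (hℓ : ℓ ≤ d) (h0 : 0 < ℓ) :
    ∑ k, atomWeight lam ℓ k = 1 := by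
  unfold atomWeight
  rw [← Finset.mul_sum, ← Finset.sum_filter]
  exact inv_mul_cancel₀ (invSum_pos hpos hℓ h0).ne'

/-- The symmetric prior supported on the points `± S^{1/2} v_k`. -/
def atomPrior (S V : Matrix (Fin d) (Fin d) ℝ) (lam : Fin d → ℝ) (ℓ : ℕ) :
    Measure (Fin d → ℝ) :=
  ∑ k : Fin d × Bool, ENNReal.ofReal (atomWeight lam ℓ k.1 / 2) •
    Measure.dirac ((if k.2 then (1 : ℝ) else -1) • (matSqrt S * V).col k.1)

theorem integral_atomPrior {E : Type*} [NormedAddCommGroup E] [NormedSpace ℝ E] [CompleteSpace E]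
    (hpos : ∀ i, 0 < lam i) (ℓ : ℕ) (g : (Fin d → ℝ) → E) :
    ∫ f, g f ∂(atomPrior S V lam ℓ) = ∑ k, (atomWeight lam ℓ k / 2) •
      (g ((matSqrt S * V).col k) + g (-(matSqrt S * V).col k)) := by
  rw [atomPrior, integral_sum_smul_dirac fun k => div_nonneg (atomWeight_nonneg hpos ℓ _) two_pos.le,
    Fintype.sum_prod_type]
  simp

theorem col_mem_ellipsoid (hS : S.PosDef) (hV : Vᵀ * V = 1) (k : Fin d) :
    (matSqrt S * V).col k ∈ ellipsoid S := by
  change quad S⁻¹ _ ≤ 1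
  have h : (matSqrt S)⁻¹ *ᵥ (matSqrt S * V).col k = V *ᵥ Pi.single k 1 := by
    rw [← Matrix.mulVec_single_one, Matrix.mulVec_mulVec, ← Matrix.mul_assoc,
      Matrix.nonsing_inv_mul _ (isUnit_det_matSqrt hS), Matrix.one_mul]
  rw [inv_eq_transpose_mul_self hS, quad_transpose_mul, h, dotProduct_self_orthogonal hV]
  simp [Pi.single_apply]

theorem isPrior_atomPrior (hS : S.PosDef) (hV : Vᵀ * V = 1) (hpos : ∀ i, 0 < lam i) {ℓ : ℕ}
    (hℓ : ℓ ≤ d) (h0 : 0 < ℓ) : IsPrior S (atomPrior S V lam ℓ) := by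
  refine ⟨isProbabilityMeasure_sum_smul_dirac
    (fun k => div_nonneg (atomWeight_nonneg hpos ℓ _) two_pos.le) ?_ _,
    ae_sum_smul_dirac _ fun k => ?_⟩
  · rw [Fintype.sum_prod_type, ← sum_atomWeight hpos hℓ h0]
    exact Finset.sum_congr rfl fun k _ => by simp; ring
  · have h := col_mem_ellipsoid hS hV k.1
    split_ifs
    · simpa using h
    · simpa [ellipsoid, Matrix.mulVec_neg] using h

theorem integral_id_atomPrior (hpos : ∀ i, 0 < lam i) (ℓ : ℕ) :
    ∫ f, f ∂(atomPrior S V lam ℓ) = 0 := by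
  rw [integral_atomPrior hpos]
  simp

theorem secondMoment_atomPrior (hpos : ∀ i, 0 < lam i) (ℓ : ℕ) :
    secondMoment (atomPrior S V lam ℓ) id = leastFavorableCov S lam V ℓ := by
  ext i j
  have h : leastFavorableCov S lam V ℓ = (invSum lam ℓ)⁻¹ • ((matSqrt S * V) *
      Matrix.diagonal (fun i : Fin d => if i.val < ℓ then (lam i)⁻¹ else 0) *
      (matSqrt S * V)ᵀ) := by
    rw [leastFavorableCov, Matrix.transpose_mul, transpose_matSqrt]
    simp only [Matrix.mul_assoc]
  rw [h]
  change ∫ f : Fin d → ℝ, f i * f j ∂_ = _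
  rw [integral_atomPrior hpos, Matrix.smul_apply, Matrix.mul_apply, smul_eq_mul, Finset.mul_sum]
  refine Finset.sum_congr rfl fun k _ => ?_
  rw [Matrix.mul_diagonal, Matrix.transpose_apply, atomWeight]
  simp only [Pi.neg_apply, Matrix.col_apply, smul_eq_mul]
  ring

end Prior

/-! ### The two sides of the game -/

section Minimax

variable {Ω : Type*} [MeasurableSpace Ω] {P : Measure Ω} {d r : ℕ} {x : Ω → Fin d → ℝ}
  {n : Ω → ℝ} {S V : Matrix (Fin d) (Fin d) ℝ} {lam : Fin d → ℝ} {ℓ : ℕ}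

theorem transpose_matSqrt_mul_self {M : Matrix (Fin d) (Fin d) ℝ} (hM : M.PosSemidef) :
    (matSqrt M)ᵀ * matSqrt M = M := by
  rw [transpose_matSqrt, matSqrt_mul_self hM]

theorem IsSortedEigendecomposition.swap_matSqrt {Sig : Matrix (Fin d) (Fin d) ℝ}
    (hSig : Sig.PosDef) (hS : S.PosDef)
    (hV : IsSortedEigendecomposition (matSqrt S * Sig * matSqrt S) lam V)
    (hpos : ∀ i, 0 < lam i) :
    IsSortedEigendecomposition (matSqrt Sig * S * matSqrt Sig) lam
      (matSqrt Sig * matSqrt S * V * Matrix.diagonal fun i => (√(lam i))⁻¹) := by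
  have h1 : (matSqrt Sig * matSqrt S)ᵀ * (matSqrt Sig * matSqrt S) =
      matSqrt S * Sig * matSqrt S := by
    conv_rhs => rw [← matSqrt_mul_self hSig.posSemidef]
    simp only [Matrix.transpose_mul, transpose_matSqrt, Matrix.mul_assoc]
  have h2 : (matSqrt Sig * matSqrt S) * (matSqrt Sig * matSqrt S)ᵀ =
      matSqrt Sig * S * matSqrt Sig := by
    conv_rhs => rw [← matSqrt_mul_self hS.posSemidef]
    simp only [Matrix.transpose_mul, transpose_matSqrt, Matrix.mul_assoc]
  rw [← h2]
  rw [← h1] at hV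
  exact hV.swap hpos

theorem posDef_conj_matSqrt {Sig : Matrix (Fin d) (Fin d) ℝ} (hSig : Sig.PosDef)
    (hS : S.PosDef) : (matSqrt S * Sig * matSqrt S).PosDef := by
  have hinj : Function.Injective (matSqrt S).mulVec := fun a b hab => by
    simpa [Matrix.nonsing_inv_mul _ (isUnit_det_matSqrt hS)] using
      congrArg ((matSqrt S)⁻¹ *ᵥ ·) hab
  have h := hSig.conjTranspose_mul_mul_same hinj
  rwa [Matrix.conjTranspose_eq_transpose_of_trivial, transpose_matSqrt] at h

theorem IsPrior.le_integral_loss {Sig : Matrix (Fin d) (Fin d) ℝ} {π : Measure (Fin d → ℝ)}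
    (hSig : Sig.PosDef) (hS : S.PosDef)
    (hV : IsSortedEigendecomposition (matSqrt S * Sig * matSqrt S) lam V)
    (hpos : ∀ i, 0 < lam i) (hℓ : ℓ ≤ d) (hπ : IsPrior S π)
    (hC : secondMoment π id = leastFavorableCov S lam V ℓ) (R : Matrix (Fin d) (Fin r) ℝ) :
    ((ℓ : ℝ) - r) / invSum lam ℓ ≤ ∫ f, loss Sig R f ∂π := by
  have h := LinearMSE.le_integral_loss (H := matSqrt Sig) (hπ.integrable_mul hS)
    (hV.swap_matSqrt hSig hS hpos).2.1 hℓ (s := (invSum lam ℓ)⁻¹)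
    (inv_nonneg.2 (Finset.sum_nonneg fun i _ => (inv_pos.2 (hpos i)).le))
    (by rw [hC, conj_leastFavorableCov hpos]) R
    (by rw [transpose_matSqrt_mul_self hSig.posSemidef]
        exact hπ.integrable_loss hS hSig.posSemidef R)
  rwa [transpose_matSqrt_mul_self hSig.posSemidef, inv_mul_eq_div] at h

theorem bddAbove_integral_regret (hSig : (secondMoment P x).PosSemidef) (hS : S.PosDef)
    (hreg : ∀ (R : Matrix (Fin d) (Fin r) ℝ) f,
      regret P x n R f = loss (secondMoment P x) R f)
    (μ : Measure (Matrix (Fin d) (Fin r) ℝ)) [IsProbabilityMeasure μ] :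
    BddAbove (Set.range fun f : ellipsoid S => ∫ R, regret P x n R f ∂μ) := by
  obtain ⟨C, hC⟩ := exists_quad_bound_ellipsoid hS (secondMoment P x)
  refine ⟨C, ?_⟩
  rintro _ ⟨f, rfl⟩
  simp_rw [hreg]
  calc _ ≤ ∫ _ : Matrix (Fin d) (Fin r) ℝ, C ∂μ :=
        integral_mono (integrable_loss_left hSig f.1 μ) (integrable_const C) fun R =>
          (loss_le_quad hSig R f.1).trans (hC f.1 f.2)
    _ = C := by simp

/-- Weak duality against `atomPrior`: the supremum over `f` dominates the average over its atoms. As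
the prior is finitely supported, exchanging the two expectations needs only linearity, not Fubini.
-/
theorem le_worstRegret (hSig : (secondMoment P x).PosDef) (hS : S.PosDef)
    (hV : IsSortedEigendecomposition (matSqrt S * secondMoment P x * matSqrt S) lam V)
    (hpos : ∀ i, 0 < lam i) (hℓ : ℓ ≤ d) (h0 : 0 < ℓ)
    (hreg : ∀ (R : Matrix (Fin d) (Fin r) ℝ) f,
      regret P x n R f = loss (secondMoment P x) R f)
    (μ : Measure (Matrix (Fin d) (Fin r) ℝ)) [IsProbabilityMeasure μ] :
    ((ℓ : ℝ) - r) / invSum lam ℓ ≤ worstRegret P x n S μ := by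
  have hprior := isPrior_atomPrior hS hV.2.1 hpos hℓ h0
  have hle := fun R : Matrix (Fin d) (Fin r) ℝ =>
    hprior.le_integral_loss hSig hS hV hpos hℓ (secondMoment_atomPrior hpos ℓ) R
  simp_rw [integral_atomPrior hpos, smul_eq_mul] at hle
  have hint (f : Fin d → ℝ) := integrable_loss_left (r := r) hSig.posSemidef f μ
  have hint2 (f g : Fin d → ℝ) (c : ℝ) : Integrable (fun R : Matrix (Fin d) (Fin r) ℝ =>
      c * (loss (secondMoment P x) R f + loss (secondMoment P x) R g)) μ :=
    ((hint f).add (hint g)).const_mul c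
  have hsup (f : Fin d → ℝ) (hf : f ∈ ellipsoid S) :
      ∫ R, loss (secondMoment P x) R f ∂μ ≤ worstRegret P x n S μ := by
    -- Boundedness is essential: an unbounded real supremum would default to 0.
    have h := le_ciSup (bddAbove_integral_regret hSig.posSemidef hS hreg μ) ⟨f, hf⟩
    simpa only [worstRegret, hreg] using h
  calc ((ℓ : ℝ) - r) / invSum lam ℓ
      = ∫ _ : Matrix (Fin d) (Fin r) ℝ, ((ℓ : ℝ) - r) / invSum lam ℓ ∂μ := by simp
    _ ≤ ∫ R, ∑ k, atomWeight lam ℓ k / 2 *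
          (loss (secondMoment P x) R ((matSqrt S * V).col k) +
            loss (secondMoment P x) R (-(matSqrt S * V).col k)) ∂μ :=
        integral_mono (integrable_const _) (integrable_finsetSum _ fun k _ => hint2 _ _ _) hle
    _ = ∑ k, atomWeight lam ℓ k / 2 *
          (∫ R, loss (secondMoment P x) R ((matSqrt S * V).col k) ∂μ +
            ∫ R, loss (secondMoment P x) R (-(matSqrt S * V).col k) ∂μ) := by
        rw [integral_finsetSum _ fun k _ => hint2 _ _ _]
        refine Finset.sum_congr rfl fun k _ => ?_
        rw [integral_const_mul, integral_add (hint _) (hint _)]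
    _ ≤ ∑ k, atomWeight lam ℓ k * worstRegret P x n S μ := by
        refine Finset.sum_le_sum fun k _ => ?_
        have hk := col_mem_ellipsoid hS hV.2.1 k
        have h1 := hsup _ hk
        have h2 := hsup (-(matSqrt S * V).col k) (by simpa [ellipsoid, Matrix.mulVec_neg] using hk)
        have := mul_le_mul_of_nonneg_left (add_le_add h1 h2)
          (div_nonneg (atomWeight_nonneg hpos ℓ k) two_pos.le)
        linarith
    _ = worstRegret P x n S μ := by rw [← Finset.sum_mul, sum_atomWeight hpos hℓ h0, one_mul]

theorem IsWeightVector.sum_loss_matSqrt_le {Sig W : Matrix (Fin d) (Fin d) ℝ}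
    (hSig : Sig.PosDef) (hW : IsSortedEigendecomposition (matSqrt Sig * S * matSqrt Sig) lam W)
    (hpos : ∀ i, 0 < lam i) {hℓ : ℓ ≤ d} (h : IsEffectiveDim r lam ℓ) {p : RSubset ℓ r → ℝ}
    (hp : IsWeightVector r lam hℓ p) {f : Fin d → ℝ} (hf : f ∈ ellipsoid S) :
    ∑ I, p I * loss Sig ((matSqrt Sig)⁻¹ * colSubset hℓ W I) f ≤
      ((ℓ : ℝ) - r) / invSum lam ℓ := by
  have hH := transpose_matSqrt_mul_self hSig.posSemidef
  have h1 := hp.sum_loss_le (transpose_matSqrt Sig) (isUnit_det_matSqrt hSig)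
    (by rw [hH]; exact hSig.posSemidef) hW hpos h f
  rw [hH] at h1
  refine h1.trans (mul_le_of_le_one_right (div_nonneg ?_ ?_) hf)
  · exact sub_nonneg.2 (by exact_mod_cast h.1.le)
  · exact Finset.sum_nonneg fun i _ => (inv_pos.2 (hpos i)).le

theorem isProbabilityMeasure_mixtureLaw (hpos : ∀ i, 0 < lam i) {hℓ : ℓ ≤ d} (hr : r < ℓ)
    {p : RSubset ℓ r → ℝ} (hp : IsWeightVector r lam hℓ p) (Sig W : Matrix (Fin d) (Fin d) ℝ) :
    IsProbabilityMeasure (mixtureLaw hℓ Sig W p) :=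
  isProbabilityMeasure_sum_smul_dirac (fun I => (hp.1 I).1) (hp.sum_eq_one hpos hr) _

theorem worstRegret_mixtureLaw_le {W : Matrix (Fin d) (Fin d) ℝ}
    (hSig : (secondMoment P x).PosDef)
    (hW : IsSortedEigendecomposition
      (matSqrt (secondMoment P x) * S * matSqrt (secondMoment P x)) lam W)
    (hpos : ∀ i, 0 < lam i) {hℓ : ℓ ≤ d} (h : IsEffectiveDim r lam ℓ) {p : RSubset ℓ r → ℝ}
    (hp : IsWeightVector r lam hℓ p)
    (hreg : ∀ (R : Matrix (Fin d) (Fin r) ℝ) f,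
      regret P x n R f = loss (secondMoment P x) R f) :
    worstRegret P x n S (mixtureLaw hℓ (secondMoment P x) W p) ≤
      ((ℓ : ℝ) - r) / invSum lam ℓ := by
  have : Nonempty (ellipsoid S) := ⟨⟨0, by simp [ellipsoid]⟩⟩
  refine ciSup_le fun f => ?_
  rw [mixtureLaw, integral_sum_smul_dirac fun I => (hp.1 I).1]
  simp_rw [hreg, smul_eq_mul]
  exact hp.sum_loss_matSqrt_le hSig hW hpos h f.2

/-- The infimum over `R` is at most the `p`-average over the matrices `H⁻¹ W_I`, whose loss is
bounded for each `f` in the ellipsoid. -/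
theorem priorRegret_le {W : Matrix (Fin d) (Fin d) ℝ} {π : Measure (Fin d → ℝ)}
    (hSig : (secondMoment P x).PosDef) (hS : S.PosDef)
    (hW : IsSortedEigendecomposition
      (matSqrt (secondMoment P x) * S * matSqrt (secondMoment P x)) lam W)
    (hpos : ∀ i, 0 < lam i) {hℓ : ℓ ≤ d} (h : IsEffectiveDim r lam ℓ) {p : RSubset ℓ r → ℝ}
    (hp : IsWeightVector r lam hℓ p)
    (hreg : ∀ (R : Matrix (Fin d) (Fin r) ℝ) f,
      regret P x n R f = loss (secondMoment P x) R f) (hπ : IsPrior S π) :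
    priorRegret r P x n π ≤ ((ℓ : ℝ) - r) / invSum lam ℓ := by
  have := hπ.1
  let R (I : RSubset ℓ r) := (matSqrt (secondMoment P x))⁻¹ * colSubset hℓ W I
  have hint (I : RSubset ℓ r) : Integrable (fun f => p I * loss (secondMoment P x) (R I) f) π :=
    (hπ.integrable_loss hS hSig.posSemidef (R I)).const_mul _
  have hinf (I : RSubset ℓ r) :
      priorRegret r P x n π ≤ ∫ f, loss (secondMoment P x) (R I) f ∂π := by
    simp_rw [priorRegret, hreg]
    refine ciInf_le ⟨0, ?_⟩ (R I)
    rintro _ ⟨R', rfl⟩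
    exact integral_nonneg fun f => loss_nonneg hSig.posSemidef R' f
  calc priorRegret r P x n π = ∑ I, p I * priorRegret r P x n π := by
        rw [← Finset.sum_mul, hp.sum_eq_one hpos h.1, one_mul]
    _ ≤ ∑ I, p I * ∫ f, loss (secondMoment P x) (R I) f ∂π :=
        Finset.sum_le_sum fun I _ => mul_le_mul_of_nonneg_left (hinf I) (hp.1 I).1
    _ = ∫ f, ∑ I, p I * loss (secondMoment P x) (R I) f ∂π := by
        rw [integral_finsetSum _ fun I _ => hint I]
        simp_rw [integral_const_mul]
    _ ≤ ∫ _ : Fin d → ℝ, ((ℓ : ℝ) - r) / invSum lam ℓ ∂π := by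
        refine integral_mono_ae (integrable_finsetSum _ fun I _ => hint I) (integrable_const _) ?_
        filter_upwards [hπ.2] with f hf
        exact hp.sum_loss_matSqrt_le hSig hW hpos h hf
    _ = _ := by simp

end Minimax

end

end LinearMSE

/-! ### The saddle point -/

theorem mainTheorem1 {Ω : Type*} [MeasurableSpace Ω] (P : Measure Ω) [IsProbabilityMeasure P]
    {d r : ℕ} (hr : r < d)
    -- the features: square integrable, centred, with invertible covariance matrix
    (x : Ω → Fin d → ℝ) (hx : Measurable x) (hx2 : MemLp x 2 P) (hx0 : ∫ ω, x ω ∂P = 0)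
    (hSig : (secondMoment P x).PosDef)
    -- the noise: square integrable, with `E[n | x] = 0`
    (n : Ω → ℝ) (hn : MemLp n 2 P)
    (hnx : P[n | MeasurableSpace.comap x inferInstance] =ᵐ[P] 0)
    (S : Matrix (Fin d) (Fin d) ℝ) (hS : S.PosDef)
    -- eigenvalues and eigenvectors of `S^{1/2} Σ_x S^{1/2}`
    (lam : Fin d → ℝ) (V : Matrix (Fin d) (Fin d) ℝ)
    (hV : IsSortedEigendecomposition (matSqrt S * secondMoment P x * matSqrt S) lam V) :
    -- all expected regrets and suprema below are finite
    (∀ μ : Measure (Matrix (Fin d) (Fin r) ℝ), IsProbabilityMeasure μ →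
      (∀ f ∈ ellipsoid S, Integrable (fun R => regret P x n R f) μ) ∧
      BddAbove (Set.range fun f : ellipsoid S => ∫ R, regret P x n R f ∂μ)) ∧
    (∀ π : Measure (Fin d → ℝ), IsPrior S π → ∀ R : Matrix (Fin d) (Fin r) ℝ,
      Integrable (fun f => regret P x n R f) π) ∧
    -- an admissible `ℓ` exists, and for any admissible `ℓ`:
    (∃ ℓ, IsEffectiveDim r lam ℓ) ∧
    ∀ (ℓ : ℕ) (hℓ : ℓ ≤ d), IsEffectiveDim r lam ℓ →
      -- the minimax regret in mixed strategies
      mixedRegret r P x n S = ((ℓ : ℝ) - r) / invSum lam ℓ ∧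
      -- the covariance matrix of the least favorable prior
      (∃ π : Measure (Fin d → ℝ), IsPrior S π ∧ ∫ f, f ∂π = 0 ∧
        secondMoment π id = leastFavorableCov S lam V ℓ) ∧
      (∀ π : Measure (Fin d → ℝ), IsPrior S π →
        secondMoment π id = leastFavorableCov S lam V ℓ →
        IsLeastFavorable r P x n S π ∧
          priorRegret r P x n π = ((ℓ : ℝ) - r) / invSum lam ℓ) ∧
      -- weights with small support
      (∃ p : RSubset ℓ r → ℝ, IsWeightVector r lam hℓ p ∧ {I | p I ≠ 0}.ncard ≤ ℓ + 1) ∧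
      -- every weight vector yields a minimax representation built from the eigenvectors `W`
      -- of `Σ_x^{1/2} S Σ_x^{1/2}`
      (∀ p : RSubset ℓ r → ℝ, IsWeightVector r lam hℓ p →
        ∑ I, p I = 1 ∧
        ∀ (lam' : Fin d → ℝ) (W : Matrix (Fin d) (Fin d) ℝ),
          IsSortedEigendecomposition
            (matSqrt (secondMoment P x) * S * matSqrt (secondMoment P x)) lam' W →
          IsMinimaxRepresentation P x n S (mixtureLaw hℓ (secondMoment P x) W p) ∧
            worstRegret P x n S (mixtureLaw hℓ (secondMoment P x) W p) =
              ((ℓ : ℝ) - r) / invSum lam ℓ) := by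
  have hP := hSig.posSemidef
  have hreg (R : Matrix (Fin d) (Fin r) ℝ) (f : Fin d → ℝ) :
      regret P x n R f = loss (secondMoment P x) R f := regret_eq_loss hx hx2 hn hnx hP R f
  have hpos := hV.pos (posDef_conj_matSqrt hSig hS)
  have hW₀ := hV.swap_matSqrt hSig hS hpos
  refine ⟨fun μ hμ => ⟨fun f _ => ?_, bddAbove_integral_regret hP hS hreg μ⟩, fun π hπ R => ?_,
    exists_isEffectiveDim hr hpos, fun ℓ hℓ h => ?_⟩
  · simp_rw [hreg]
    exact integrable_loss_left hP f μ
  · simp_rw [hreg]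
    exact hπ.integrable_loss hS hP R
  have h0 : 0 < ℓ := (Nat.zero_le r).trans_lt h.1
  obtain ⟨p₀, hp₀, hp₀c⟩ := exists_isWeightVector hV.1 hpos h hℓ
  have hlow (μ : Measure (Matrix (Fin d) (Fin r) ℝ)) (hμ : IsProbabilityMeasure μ) :=
    le_worstRegret hSig hS hV hpos hℓ h0 hreg μ
  have hprior (π : Measure (Fin d → ℝ)) (hπ : IsPrior S π)
      (hC : secondMoment π id = leastFavorableCov S lam V ℓ) :
      priorRegret r P x n π = ((ℓ : ℝ) - r) / invSum lam ℓ := by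
    refine le_antisymm (priorRegret_le hSig hS hW₀ hpos h hp₀ hreg hπ) (le_ciInf fun R => ?_)
    simp_rw [hreg]
    exact hπ.le_integral_loss hSig hS hV hpos hℓ hC R
  refine ⟨?_, ?_, ?_, ⟨p₀, hp₀, hp₀c⟩, ?_⟩
  · have hμ₀ := isProbabilityMeasure_mixtureLaw hpos h.1 hp₀ (secondMoment P x)
      (matSqrt (secondMoment P x) * matSqrt S * V * Matrix.diagonal fun i => (√(lam i))⁻¹)
    have : Nonempty (ProbabilityMeasure (Matrix (Fin d) (Fin r) ℝ)) := ⟨⟨_, hμ₀⟩⟩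
    refine le_antisymm ?_ (le_ciInf fun μ => hlow μ μ.2)
    have hbdd : BddBelow (Set.range fun μ : ProbabilityMeasure (Matrix (Fin d) (Fin r) ℝ) =>
        worstRegret P x n S (μ : Measure (Matrix (Fin d) (Fin r) ℝ))) :=
      ⟨((ℓ : ℝ) - r) / invSum lam ℓ, by rintro _ ⟨μ, rfl⟩; exact hlow μ μ.2⟩
    have hinf := ciInf_le hbdd ⟨_, hμ₀⟩
    exact hinf.trans (worstRegret_mixtureLaw_le hSig hW₀ hpos h hp₀ hreg)
  · exact ⟨atomPrior S V lam ℓ, isPrior_atomPrior hS hV.2.1 hpos hℓ h0,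
      integral_id_atomPrior hpos ℓ, secondMoment_atomPrior hpos ℓ⟩
  · exact fun π hπ hC => ⟨⟨hπ, fun π' hπ' => (priorRegret_le hSig hS hW₀ hpos h hp₀ hreg
      hπ').trans (hprior π hπ hC).ge⟩, hprior π hπ hC⟩
  · refine fun p hp => ⟨hp.sum_eq_one hpos h.1, fun lam' W hW => ?_⟩
    -- `W` need not be the matrix built from `V`, but both diagonalise the same matrix, so the
    -- eigenvalues agree, and the upper bound holds for any such `W`.
    obtain rfl : lam = lam' := hW₀.eigenvalues_unique hW rfl
    have hμ := isProbabilityMeasure_mixtureLaw hpos h.1 hp (secondMoment P x) W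
    have hle := worstRegret_mixtureLaw_le hSig hW hpos h hp hreg
    exact ⟨⟨hμ, fun μ' hμ' => hle.trans (hlow μ' hμ')⟩, le_antisymm hle (hlow _ hμ)⟩
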